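/- Let $(A_0,A_1)$ be a compatible couple of quasi-normed spaces, i.e. $A_0,A_1$ are continuously embedded in one Hausdorff topological vector space. For $f\in A_0+A_1$ and $t>0$ put $K(t,f;A_0,A_1)=\inf\{\|f_0\|_{A_0}+t\|f_1\|_{A_1}: f=f_0+f_1,\ f_j\in A_j\}$. For non-negative quantities, $F\approx G$ means $cG\le F\le CG$ with constants $0<c\le C<\infty$ independent of the variable. A Lebesgue measurable $b:(0,\infty)\to(0,\infty)$ is slowly varying ($b\in SV$) if for every $\varepsilon>0$ there are a positive non-decreasing function $g$ and a positive non-increasing function $h$ on $(0,\infty)$ with $t^{\varepsilon}b(t)\approx g(t)$ and $t^{-\varepsilon}b(t)\approx h(t)$, $t>0$. For $0<q<\infty$, $b\in SV_{0,q}$ means that $b\in SV$ and $\int_1^\infty b^q(u)\frac{du}{u}<\infty$. For $0\le\theta\le 1$, $0<q<\infty$ and a positive function $b$ on $(0,\infty)$, the space $\bar A_{\theta,q;b}=(A_0,A_1)_{\theta,q;b}$ consists of all $f\in A_0+A_1$ with $$\|f\|_{\bar A_{\theta,q;b}}=\left(\int_0^\infty\left[t^{-\theta}b(t)K(t,f;A_0,A_1)\right]^q\frac{dt}{t}\right)^{1/q}<\infty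 .$$ The couple is $K$-surjective if for every quasi-concave $\phi:(0,\infty)\to(0,\infty)$ (i.e. $\phi(t)$ and $t\phi(1/t)$ are non-decreasing) there is $f\in A_0+A_1$ with $\phi(t)\approx K(t,f;A_0,A_1)$, $t>0$. **Theorem.** Let $0<q_0,q_1,q<\infty$, $0<\theta<1$, $b_j\in SV_{0,q_j}$ $(j=0,1)$ and $b\in SV$. For $t>0$ and $\epsilon>0$ put $$\rho(t)=\frac{\left(\int_t^\infty b_0^{q_0}(u)\frac{du}{u}\right)^{1/q_0}}{\left(\int_t^\infty b_1^{q_1}(u)\frac{du}{u}\right)^{1/q_1}},\qquad \rho_\epsilon(t)=\frac{\left(\int_t^\infty b_0^{q_0}(u)\frac{du}{u}\right)^{(1+\epsilon)/q_0}}{\left(\int_t^\infty b_1^{q_1}(u)\frac{du}{u}\right)^{1/q_1}} .$$ Assume that $\rho$ is non-decreasing on $(0,\infty)$ with $\lim_{t\to0^+}\rho(t)=0$ and $\lim_{t\to\infty}\rho(t)=\infty$. If $q_0\ne q_1$, assume in addition that for some $\epsilon>0$ the function $\rho_\epsilon$ is equivalent ($\approx$) on $(0,\infty)$ to a non-decreasing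 function. If $q_0=q_1$, assume in addition that $(A_0,A_1)$ is $K$-surjective and that $$\frac{\rho'(t)}{\rho(t)}\approx\frac{t^{-1}b_1^{q_1}(t)}{\int_t^\infty b_1^{q_1}(u)\frac{du}{u}}\qquad\text{for almost every } t>0 .$$ Put $$\tilde b(t)=[\rho(t)]^{1-\theta}\,b(\rho(t))\,[b_1(t)]^{q_1/q}\left(\int_t^\infty b_1^{q_1}(u)\frac{du}{u}\right)^{1/q_1-1/q},\quad t>0 .$$ Then $$\left(\bar A_{0,q_0;b_0},\bar A_{0,q_1;b_1}\right)_{\theta,q;b}=\bar A_{0,q;\tilde b},$$ that is, the two spaces consist of the same elements and their quasi-norms are equivalent, with constants independent of the element. -/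

import Mathlib

open Set Filter Topology MeasureTheory
open scoped ENNReal NNReal

namespace LimitingReiteration

noncomputable section

/-- A function `b` on `(0,∞)` is slowly varying: it is positive, Lebesgue measurable and, for every
`ε > 0`, `t ^ ε * b t` is equivalent to a positive non-decreasing function and `t ^ (-ε) * b t` is
equivalent to a positive non-increasing function on `(0,∞)`. -/
structure IsSlowlyVarying (b : ℝ → ℝ) : Prop where
  pos : ∀ t, 0 < t → 0 < b t
  aemeasurable : AEMeasurable b (volume.restrict (Ioi 0))
  equiv_monotone : ∀ ε : ℝ, 0 < ε → ∃ g : ℝ → ℝ, (∀ t, 0 < t → 0 < g t) ∧ MonotoneOn g (Ioi 0) ∧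
    ∃ c C : ℝ, 0 < c ∧ 0 < C ∧ ∀ t, 0 < t → c * g t ≤ t ^ ε * b t ∧ t ^ ε * b t ≤ C * g t
  equiv_antitone : ∀ ε : ℝ, 0 < ε → ∃ g : ℝ → ℝ, (∀ t, 0 < t → 0 < g t) ∧ AntitoneOn g (Ioi 0) ∧
    ∃ c C : ℝ, 0 < c ∧ 0 < C ∧ ∀ t, 0 < t → c * g t ≤ t ^ (-ε) * b t ∧ t ^ (-ε) * b t ≤ C * g t

/-- The class `SV_{0,q}`, `0 < q < ∞`: slowly varying `b` with `∫_1^∞ b(u)^q du/u < ∞`, that is,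
`u ^ (-1/q) * b u` belongs to `L^q(1,∞)`. -/
structure IsSV0 (q : ℝ) (b : ℝ → ℝ) : Prop where
  slowlyVarying : IsSlowlyVarying b
  integrable_tail : IntegrableOn (fun u => b u ^ q / u) (Ioi 1)

/-- The tail integral `∫_t^∞ b(u)^q du/u`. -/
def tail (q : ℝ) (b : ℝ → ℝ) (t : ℝ) : ℝ := ∫ u in Ioi t, b u ^ q / u

/-- The `L^q(t,∞)` quasi-norm of `u ^ (-1/q) * b u`, `0 < q < ∞`. -/
def tailNorm (q : ℝ) (b : ℝ → ℝ) (t : ℝ) : ℝ := tail q b t ^ (1 / q)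

/-- `ρ(t) = ‖u^{-1/q₀} b₀(u)‖_{q₀,(t,∞)} / ‖u^{-1/q₁} b₁(u)‖_{q₁,(t,∞)}`. -/
def rho (q₀ q₁ : ℝ) (b₀ b₁ : ℝ → ℝ) (t : ℝ) : ℝ := tailNorm q₀ b₀ t / tailNorm q₁ b₁ t

/-- `ρ_ε(t) = ‖u^{-1/q₀} b₀(u)‖_{q₀,(t,∞)}^{1+ε} / ‖u^{-1/q₁} b₁(u)‖_{q₁,(t,∞)}`. -/
def rhoEps (ε q₀ q₁ : ℝ) (b₀ b₁ : ℝ → ℝ) (t : ℝ) : ℝ :=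
  tailNorm q₀ b₀ t ^ (1 + ε) / tailNorm q₁ b₁ t

/-- `F` is equivalent on `(0,∞)` to a non-decreasing function. -/
def EquivNondecreasing (F : ℝ → ℝ) : Prop :=
  ∃ g : ℝ → ℝ, MonotoneOn g (Ioi 0) ∧
    ∃ c C : ℝ, 0 < c ∧ 0 < C ∧ ∀ t, 0 < t → c * g t ≤ F t ∧ F t ≤ C * g t

/-- The weight
`b̃(t) = ρ(t)^{1-θ} b(ρ(t)) b₁(t)^{q₁/q} (∫_t^∞ b₁(u)^{q₁} du/u)^{1/q₁ - 1/q}`. -/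
def btilde (θ q q₀ q₁ : ℝ) (b b₀ b₁ : ℝ → ℝ) (t : ℝ) : ℝ :=
  rho q₀ q₁ b₀ b₁ t ^ (1 - θ) * b (rho q₀ q₁ b₀ b₁ t) * b₁ t ^ (q₁ / q) *
    tail q₁ b₁ t ^ (1 / q₁ - 1 / q)

section Couples

variable {V : Type*} [AddCommGroup V]

/-- A quasi-normed space `A` continuously embedded in a topological vector space `V` is encoded by
its quasi-norm, extended to `V` by the value `∞` outside `A`; so `A = {x | N x < ∞}`, which is a
linear subspace of `V` by `smul` and `add_le`, and `N` is a quasi-norm on it. -/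
structure IsEmbeddedQuasiNorm (𝕜 : Type*) [RCLike 𝕜] [Module 𝕜 V] [TopologicalSpace V]
    (N : V → ℝ≥0∞) : Prop where
  smul : ∀ (c : 𝕜) (x : V), N (c • x) = ‖c‖ₑ * N x
  add_le : ∃ C : ℝ≥0, ∀ x y : V, N (x + y) ≤ C * (N x + N y)
  eq_zero : ∀ x : V, N x = 0 → x = 0
  continuous_embedding : ∀ U ∈ 𝓝 (0 : V), ∃ δ : ℝ≥0∞, 0 < δ ∧ ∀ x : V, N x < δ → x ∈ U

/-- The sum `A₀ + A₁` of the spaces `A_j = {x | N_j x < ∞}`. -/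
def sumSpace (N₀ N₁ : V → ℝ≥0∞) : Set V :=
  {f | ∃ f₀ f₁ : V, N₀ f₀ < ∞ ∧ N₁ f₁ < ∞ ∧ f₀ + f₁ = f}

/-- Peetre's `K`-functional `K(t,f;A₀,A₁)`, `t > 0`, of the couple `A_j = {x | N_j x < ∞}`.
Decompositions with `f₀ ∉ A₀` or `f₁ ∉ A₁` contribute the value `∞`, so that they play no role if
`f ∈ A₀ + A₁`, and `K(t,f;A₀,A₁) = ∞` if `f ∉ A₀ + A₁`. -/
def KFun (N₀ N₁ : V → ℝ≥0∞) (t : ℝ) (f : V) : ℝ≥0∞ :=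
  ⨅ (f₀ : V) (f₁ : V) (_ : f₀ + f₁ = f), N₀ f₀ + ENNReal.ofReal t * N₁ f₁

/-- The quasi-norm of `(A₀, A₁)_{θ,q;b}`, `0 < q < ∞`: the `L^q(0,∞)` quasi-norm of
`t ^ (-θ - 1/q) * b t * K(t,f;A₀,A₁)`, with value `∞` where it is not finite. -/
def interpNorm (N₀ N₁ : V → ℝ≥0∞) (θ q : ℝ) (b : ℝ → ℝ) (f : V) : ℝ≥0∞ :=
  (∫⁻ t in Ioi (0 : ℝ),
    (ENNReal.ofReal (t ^ (-θ - 1 / q) * b t) * KFun N₀ N₁ t f) ^ q) ^ (1 / q)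

/-- The `K`-interpolation space `(A₀, A₁)_{θ,q;b}`. -/
def interpSpace (N₀ N₁ : V → ℝ≥0∞) (θ q : ℝ) (b : ℝ → ℝ) : Set V :=
  {f | f ∈ sumSpace N₀ N₁ ∧ interpNorm N₀ N₁ θ q b f < ∞}

/-- A positive function `φ` on `(0,∞)` is quasi-concave if `φ` and `t ↦ t * φ (1/t)` are
non-decreasing. -/
structure IsQuasiConcave (φ : ℝ → ℝ) : Prop where
  pos : ∀ t, 0 < t → 0 < φ t
  monotone : MonotoneOn φ (Ioi 0)
  monotone_dual : MonotoneOn (fun t => t * φ (1 / t)) (Ioi 0)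

/-- The couple is `K`-surjective: every quasi-concave function is equivalent on `(0,∞)` to
`K(·,f;A₀,A₁)` for some `f ∈ A₀ + A₁`. -/
def KSurjective (N₀ N₁ : V → ℝ≥0∞) : Prop :=
  ∀ φ : ℝ → ℝ, IsQuasiConcave φ → ∃ f ∈ sumSpace N₀ N₁, ∃ c C : ℝ, 0 < c ∧ 0 < C ∧
    ∀ t, 0 < t → ENNReal.ofReal (c * φ t) ≤ KFun N₀ N₁ t f ∧
      KFun N₀ N₁ t f ≤ ENNReal.ofReal (C * φ t)

end Couples

end

end LimitingReiteration

/-!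
Write `n₀`, `n₁` for the tail norms of `b₀`, `b₁`, so that `ρ = n₀ / n₁`, and `K` for the
`K`-functional of the couple `(A₀, A₁)`. As in Holmstedt's formula, the `K`-functional at `ρ(t)` of
the couple of limiting spaces is at most a constant times the `L^{q₀}` norm of `K` over `(0, t)`
plus `ρ(t)` times its `L^{q₁}` norm over `(t, ∞)`, both weighted. From below the much weaker bound
by a multiple of `n₀(t) K(t)` suffices.

Either growth hypothesis makes `ρ n₁ ^ α` equivalent to a non-decreasing function for some `α > 0`.
Hence along points `t_k` at which `n₁` decreases geometrically with a large enough ratio, `ρ` grows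
geometrically. Discretised at these points, the quasi-norm of `f` in the space with weight `btilde`
becomes the `ℓ^q` norm of the sequence `ρ(t_k)^{-θ} b(ρ(t_k)) n₀(t_k) K(t_k, f)`, while the
reiterated quasi-norm becomes the same with `n₀(t_k) K(t_k, f)` replaced by the `K`-functional of
the limiting spaces at `ρ(t_k)`. A discrete Hardy inequality absorbs the two weighted norms into
single terms.
-/

namespace LimitingReiteration

section KFunctional

variable {V : Type*} [AddCommGroup V] {N₀ N₁ : V → ℝ≥0∞}

/-- The properties of a quasi-norm that the `K`-method uses: it may vanish at nonzero vectors, and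
homogeneity is only required for the scalars `0` and `-1`. As in `IsEmbeddedQuasiNorm`, the space is
`{x | N x < ∞}`. -/
structure IsQuasiSeminorm (N : V → ℝ≥0∞) : Prop where
  map_zero : N 0 = 0
  map_neg : ∀ x, N (-x) = N x
  add_le : ∃ C : ℝ≥0, ∀ x y, N (x + y) ≤ C * (N x + N y)

theorem IsEmbeddedQuasiNorm.isQuasiSeminorm {𝕜 : Type*} [RCLike 𝕜] [Module 𝕜 V]
    [TopologicalSpace V] {N : V → ℝ≥0∞} (h : IsEmbeddedQuasiNorm 𝕜 N) : IsQuasiSeminorm N where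
  map_zero := by simpa using h.smul 0 0
  map_neg x := by simpa using h.smul (-1) x
  add_le := h.add_le

theorem KFun_le {f f₀ f₁ : V} (h : f₀ + f₁ = f) (t : ℝ) :
    KFun N₀ N₁ t f ≤ N₀ f₀ + ENNReal.ofReal t * N₁ f₁ :=
  iInf_le_of_le f₀ (iInf_le_of_le f₁ (iInf_le_of_le h le_rfl))

theorem le_KFun {f : V} {t : ℝ} {a : ℝ≥0∞}
    (h : ∀ f₀ f₁ : V, f₀ + f₁ = f → a ≤ N₀ f₀ + ENNReal.ofReal t * N₁ f₁) :
    a ≤ KFun N₀ N₁ t f :=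
  le_iInf fun f₀ => le_iInf fun f₁ => le_iInf fun hf => h f₀ f₁ hf

theorem le_add_mul_KFun {f : V} {t : ℝ} {a b c : ℝ≥0∞} (hc₀ : c ≠ 0) (hc : c ≠ ∞)
    (h : ∀ f₀ f₁ : V, f₀ + f₁ = f → a ≤ b + c * (N₀ f₀ + ENNReal.ofReal t * N₁ f₁)) :
    a ≤ b + c * KFun N₀ N₁ t f := by
  rw [← tsub_le_iff_left, ← ENNReal.div_le_iff' hc₀ hc]
  refine le_KFun fun f₀ f₁ hf => ?_
  rw [ENNReal.div_le_iff' hc₀ hc, tsub_le_iff_left]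
  exact h f₀ f₁ hf

theorem KFun_mono (f : V) : Monotone fun t => KFun N₀ N₁ t f := fun s t hst =>
  le_KFun fun f₀ f₁ hf => (KFun_le hf s).trans (by gcongr)

theorem KFun_le_left (h₁ : N₁ 0 = 0) (t : ℝ) (f : V) : KFun N₀ N₁ t f ≤ N₀ f := by
  simpa [h₁] using KFun_le (N₀ := N₀) (N₁ := N₁) (add_zero f) t

theorem KFun_le_right (h₀ : N₀ 0 = 0) (t : ℝ) (f : V) :
    KFun N₀ N₁ t f ≤ ENNReal.ofReal t * N₁ f := by
  simpa [h₀] using KFun_le (N₀ := N₀) (N₁ := N₁) (zero_add f) t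

theorem KFun_neg_le (h₀ : ∀ x, N₀ (-x) = N₀ x) (h₁ : ∀ x, N₁ (-x) = N₁ x) (t : ℝ) (f : V) :
    KFun N₀ N₁ t (-f) ≤ KFun N₀ N₁ t f :=
  le_KFun fun f₀ f₁ hf => by
    simpa [h₀, h₁] using KFun_le (N₀ := N₀) (N₁ := N₁) (f₀ := -f₀) (f₁ := -f₁) (f := -f)
      (by rw [← hf]; abel) t

theorem exists_KFun_add_le (h₀ : IsQuasiSeminorm N₀) (h₁ : IsQuasiSeminorm N₁) :
    ∃ C : ℝ≥0∞, C ≠ 0 ∧ C ≠ ∞ ∧ ∀ (t : ℝ) (f g : V),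
      KFun N₀ N₁ t (f + g) ≤ C * (KFun N₀ N₁ t f + KFun N₀ N₁ t g) := by
  obtain ⟨C₀, hC₀⟩ := h₀.add_le
  obtain ⟨C₁, hC₁⟩ := h₁.add_le
  have hC : (C₀ + C₁ + 1 : ℝ≥0∞) ≠ 0 := by simp
  refine ⟨C₀ + C₁ + 1, hC, by finiteness, fun t f g => ?_⟩
  rw [mul_add]
  refine le_add_mul_KFun hC (by finiteness) fun g₀ g₁ hg => ?_
  rw [add_comm (_ * _)]
  refine le_add_mul_KFun hC (by finiteness) fun f₀ f₁ hf => ?_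
  calc KFun N₀ N₁ t (f + g) ≤ N₀ (f₀ + g₀) + ENNReal.ofReal t * N₁ (f₁ + g₁) :=
        KFun_le (by rw [← hf, ← hg]; abel) t
    _ ≤ C₀ * (N₀ f₀ + N₀ g₀) + ENNReal.ofReal t * (C₁ * (N₁ f₁ + N₁ g₁)) := by
        gcongr
        exacts [hC₀ _ _, hC₁ _ _]
    _ ≤ (C₀ + C₁ + 1) * (N₀ f₀ + N₀ g₀) +
          ENNReal.ofReal t * ((C₀ + C₁ + 1) * (N₁ f₁ + N₁ g₁)) := by
        gcongr
        exacts [le_self_add.trans le_self_add, le_add_self.trans le_self_add]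
    _ = _ := by ring

theorem exists_KFun_sub_le (h₀ : IsQuasiSeminorm N₀) (h₁ : IsQuasiSeminorm N₁) :
    ∃ C : ℝ≥0∞, C ≠ ∞ ∧ ∀ (t : ℝ) (f g : V),
      KFun N₀ N₁ t (f - g) ≤ C * (KFun N₀ N₁ t f + KFun N₀ N₁ t g) := by
  obtain ⟨C, -, hC, hadd⟩ := exists_KFun_add_le h₀ h₁
  refine ⟨C, hC, fun t f g => ?_⟩
  rw [sub_eq_add_neg]
  exact (hadd t f (-g)).trans (by gcongr; exact KFun_neg_le h₀.map_neg h₁.map_neg t g)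

theorem mem_sumSpace_of_KFun_lt_top {f : V} {t : ℝ} (ht : 0 < t) (h : KFun N₀ N₁ t f < ∞) :
    f ∈ sumSpace N₀ N₁ := by
  contrapose! h
  rw [top_le_iff, ← top_le_iff]
  refine le_KFun fun f₀ f₁ hf => ?_
  have : N₀ f₀ = ∞ ∨ N₁ f₁ = ∞ := by
    by_contra! hfin
    exact h ⟨f₀, f₁, hfin.1.lt_top, hfin.2.lt_top, hf⟩
  rcases this with h | h <;> simp [h, ENNReal.mul_top, ht]

end KFunctional

section InterpolationNorm

variable {V : Type*} [AddCommGroup V] {N₀ N₁ : V → ℝ≥0∞}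

/-- The density of the measure `b(u)^q du/u` on `(0,∞)`, whose tails are `tail q b`. -/
noncomputable def density (q : ℝ) (b : ℝ → ℝ) (u : ℝ) : ℝ≥0∞ := ENNReal.ofReal (b u ^ q / u)

theorem density_pos {q : ℝ} {b : ℝ → ℝ} {u : ℝ} (hu : 0 < u) (hb : 0 < b u) :
    0 < density q b u :=
  ENNReal.ofReal_pos.2 (div_pos (Real.rpow_pos_of_pos hb q) hu)

theorem density_eq {q : ℝ} (hq : 0 ≤ q) {b : ℝ → ℝ} {u : ℝ} (hb : 0 ≤ b u) :
    density q b u = ENNReal.ofReal (b u) ^ q * ENNReal.ofReal u⁻¹ := by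
  rw [density, div_eq_mul_inv, ENNReal.ofReal_mul (by positivity),
    ENNReal.ofReal_rpow_of_nonneg hb hq]

theorem interpNorm_rpow {θ q : ℝ} (hq : 0 < q) {b : ℝ → ℝ} (hb : ∀ t, 0 < t → 0 < b t) (f : V) :
    interpNorm N₀ N₁ θ q b f ^ q =
      ∫⁻ t in Ioi 0, density q (fun s => s ^ (-θ) * b s) t * KFun N₀ N₁ t f ^ q := by
  rw [interpNorm, ← ENNReal.rpow_mul, one_div_mul_cancel hq.ne', ENNReal.rpow_one]
  refine setLIntegral_congr_fun measurableSet_Ioi fun t (ht : 0 < t) => ?_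
  have hbt := hb t ht
  simp only [density]
  rw [ENNReal.mul_rpow_of_nonneg _ _ hq.le, ENNReal.ofReal_rpow_of_nonneg (by positivity) hq.le]
  congr 2
  rw [sub_eq_add_neg, Real.rpow_add ht, mul_right_comm,
    Real.mul_rpow (by positivity) (by positivity), ← Real.rpow_mul ht.le, neg_mul,
    one_div_mul_cancel hq.ne', Real.rpow_neg_one, div_eq_mul_inv]

theorem mem_sumSpace_of_interpNorm_lt_top {θ q : ℝ} (hq : 0 < q) {b : ℝ → ℝ}
    (hb : ∀ t, 0 < t → 0 < b t) {f : V} (hf : interpNorm N₀ N₁ θ q b f < ∞) :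
    f ∈ sumSpace N₀ N₁ := by
  contrapose! hf
  have hK (t : ℝ) (ht : 0 < t) : KFun N₀ N₁ t f = ∞ := by
    contrapose! hf
    exact mem_sumSpace_of_KFun_lt_top ht hf.lt_top
  refine (ENNReal.rpow_eq_top_iff_of_pos hq).1 ?_ |>.ge
  rw [interpNorm_rpow hq hb, setLIntegral_congr_fun (g := fun _ => ∞) measurableSet_Ioi]
  · simp
  · intro t (ht : 0 < t)
    have hw : 0 < t ^ (-θ) * b t := mul_pos (Real.rpow_pos_of_pos ht _) (hb t ht)
    have hd : density q (fun s => s ^ (-θ) * b s) t ≠ 0 := (density_pos ht hw).ne'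
    simp [hK t ht, hq, ENNReal.mul_top hd]

theorem mem_interpSpace_iff {θ q : ℝ} (hq : 0 < q) {b : ℝ → ℝ} (hb : ∀ t, 0 < t → 0 < b t)
    {f : V} : f ∈ interpSpace N₀ N₁ θ q b ↔ interpNorm N₀ N₁ θ q b f < ∞ :=
  ⟨And.right, fun hf => ⟨mem_sumSpace_of_interpNorm_lt_top hq hb hf, hf⟩⟩

end InterpolationNorm

section SlowlyVarying

theorem EquivNondecreasing.exists_le_mul {F : ℝ → ℝ} (hF : EquivNondecreasing F) :
    ∃ M : ℝ, 0 < M ∧ ∀ s u : ℝ, 0 < s → s ≤ u → F s ≤ M * F u := by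
  obtain ⟨g, hg, c, C, hc, hC, h⟩ := hF
  refine ⟨C / c, by positivity, fun s u hs hsu => ?_⟩
  have hu : 0 < u := hs.trans_le hsu
  calc F s ≤ C * g s := (h s hs).2
    _ ≤ C * g u := by gcongr; exact hg hs hu hsu
    _ = C / c * (c * g u) := by field_simp
    _ ≤ C / c * F u := by gcongr; exact (h u hu).1

variable {b : ℝ → ℝ} {ε : ℝ}

theorem IsSlowlyVarying.exists_le_mul_right (hb : IsSlowlyVarying b) (hε : 0 < ε) :
    ∃ M : ℝ, 0 < M ∧ ∀ s u : ℝ, 0 < s → s ≤ u → b s ≤ M * (u / s) ^ ε * b u := by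
  obtain ⟨g, -, hg, hgb⟩ := hb.equiv_monotone ε hε
  obtain ⟨M, hM, h⟩ := EquivNondecreasing.exists_le_mul ⟨g, hg, hgb⟩
  refine ⟨M, hM, fun s u hs hsu => ?_⟩
  have hu : 0 < u := hs.trans_le hsu
  calc b s = (s ^ ε * b s) / s ^ ε := by field_simp
    _ ≤ M * (u ^ ε * b u) / s ^ ε := by gcongr ?_ / _; exact h s u hs hsu
    _ = M * (u / s) ^ ε * b u := by rw [Real.div_rpow hu.le hs.le]; ring

theorem IsSlowlyVarying.exists_le_mul_left (hb : IsSlowlyVarying b) (hε : 0 < ε) :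
    ∃ M : ℝ, 0 < M ∧ ∀ s u : ℝ, 0 < s → s ≤ u → b u ≤ M * (u / s) ^ ε * b s := by
  obtain ⟨g, -, hg, c, C, hc, hC, hgb⟩ := hb.equiv_antitone ε hε
  refine ⟨C / c, by positivity, fun s u hs hsu => ?_⟩
  have hu : 0 < u := hs.trans_le hsu
  calc b u = u ^ ε * (u ^ (-ε) * b u) := by rw [Real.rpow_neg hu.le]; field_simp
    _ ≤ u ^ ε * (C * g s) := by
      gcongr ?_ * ?_
      exact (hgb u hu).2.trans (by gcongr; exact hg hs hu hsu)
    _ = u ^ ε * (C / c * (c * g s)) := by field_simp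
    _ ≤ u ^ ε * (C / c * (s ^ (-ε) * b s)) := by gcongr _ * (_ * ?_); exact (hgb s hs).1
    _ = C / c * (u / s) ^ ε * b s := by
      rw [Real.div_rpow hu.le hs.le, Real.rpow_neg hs.le]; ring

end SlowlyVarying

section AbsoluteContinuity

variable {f g : ℝ → ℝ} {s t : ℝ}

theorem absolutelyContinuousOnInterval_of_dist_le (hf : AbsolutelyContinuousOnInterval f s t)
    {L : ℝ≥0} (h : ∀ x ∈ uIcc s t, ∀ y ∈ uIcc s t, dist (g x) (g y) ≤ L * dist (f x) (f y)) :
    AbsolutelyContinuousOnInterval g s t := by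
  rw [absolutelyContinuousOnInterval_iff] at *
  intro ε hε
  obtain ⟨δ, hδ, hf⟩ := hf (ε / (L + 1)) (by positivity)
  refine ⟨δ, hδ, fun E hE hlt => ?_⟩
  calc ∑ i ∈ Finset.range E.1, dist (g (E.2 i).1) (g (E.2 i).2)
      ≤ ∑ i ∈ Finset.range E.1, L * dist (f (E.2 i).1) (f (E.2 i).2) :=
        Finset.sum_le_sum fun i hi => h _ (hE.1 i hi).1 _ (hE.1 i hi).2
    _ ≤ (L + 1) * ∑ i ∈ Finset.range E.1, dist (f (E.2 i).1) (f (E.2 i).2) := by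
        rw [← Finset.mul_sum]
        gcongr
        exact le_add_of_nonneg_right zero_le_one
    _ < (L + 1) * (ε / (L + 1)) := by gcongr; exact hf E hE hlt
    _ = ε := by field_simp

theorem absolutelyContinuousOnInterval_log (hf : AbsolutelyContinuousOnInterval f s t)
    (hpos : ∀ x ∈ uIcc s t, 0 < f x) :
    AbsolutelyContinuousOnInterval (fun x => Real.log (f x)) s t := by
  obtain ⟨x₀, hx₀, hmin⟩ := isCompact_uIcc.exists_isMinOn nonempty_uIcc hf.continuousOn
  have hm : 0 < f x₀ := hpos x₀ hx₀
  have hlip : LipschitzOnWith (f x₀).toNNReal⁻¹ Real.log (Ici (f x₀)) := by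
    refine (convex_Ici _).lipschitzOnWith_of_nnnorm_deriv_le
      (fun y hy => Real.differentiableAt_log (hm.trans_le hy).ne') fun y (hy : f x₀ ≤ y) => ?_
    rw [Real.deriv_log, nnnorm_inv, ← Real.toNNReal_eq_nnnorm_of_nonneg (hm.trans_le hy).le]
    gcongr
  exact absolutelyContinuousOnInterval_of_dist_le hf fun x hx y hy =>
    hlip.dist_le_mul _ (hmin hx) _ (hmin hy)

theorem le_of_ae_deriv_nonneg (hf : AbsolutelyContinuousOnInterval f s t) (hst : s ≤ t)
    (hderiv : ∀ᵐ x, x ∈ Ioc s t → 0 ≤ deriv f x) : f s ≤ f t := by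
  rw [← sub_nonneg, ← hf.integral_deriv_eq_sub, intervalIntegral.integral_of_le hst]
  exact setIntegral_nonneg_of_ae_restrict ((ae_restrict_iff' measurableSet_Ioc).2 hderiv)

end AbsoluteContinuity

section Tail

variable {q : ℝ} {b : ℝ → ℝ}

theorem IsSV0.pos (hb : IsSV0 q b) {t : ℝ} (ht : 0 < t) : 0 < b t := hb.slowlyVarying.pos t ht

theorem IsSV0.rpow_div_pos (hb : IsSV0 q b) {t : ℝ} (ht : 0 < t) : 0 < b t ^ q / t :=
  div_pos (Real.rpow_pos_of_pos (hb.pos ht) q) ht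

theorem IsSV0.aemeasurable_rpow_div (hb : IsSV0 q b) :
    AEMeasurable (fun u => b u ^ q / u) (volume.restrict (Ioi 0)) :=
  (hb.slowlyVarying.aemeasurable.pow_const q).div measurable_id.aemeasurable

theorem IsSV0.integrableOn_Ioi (hq : 0 < q) (hb : IsSV0 q b) {t : ℝ} (ht : 0 < t) :
    IntegrableOn (fun u => b u ^ q / u) (Ioi t) := by
  have h1 : IntegrableOn (fun u => b u ^ q / u) (Ioc t 1) := by
    obtain ⟨M, hM, h⟩ := hb.slowlyVarying.exists_le_mul_right one_pos
    refine IntegrableOn.of_bound measure_Ioc_lt_top ?_ ((M * (1 / t) ^ (1 : ℝ) * b 1) ^ q / t) ?_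
    · have hsub : Ioc t 1 ⊆ Ioi 0 := fun u hu => ht.trans hu.1
      exact (hb.aemeasurable_rpow_div.mono_measure
        (Measure.restrict_mono hsub le_rfl)).aestronglyMeasurable
    · filter_upwards [ae_restrict_mem measurableSet_Ioc] with u hu
      have hu0 : 0 < u := ht.trans hu.1
      have hb1 := hb.pos one_pos
      rw [Real.norm_of_nonneg (hb.rpow_div_pos hu0).le]
      refine div_le_div₀ (by positivity) ?_ ht hu.1.le
      refine Real.rpow_le_rpow (hb.pos hu0).le ((h u 1 hu0 hu.2).trans ?_) hq.le
      gcongr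
      exact hu.1.le
  exact (h1.union hb.integrable_tail).mono_set fun u hu => (le_or_gt u 1).imp (⟨hu, ·⟩) id

theorem IsSV0.integrableOn_Ioc (hq : 0 < q) (hb : IsSV0 q b) {s : ℝ} (hs : 0 < s) (t : ℝ) :
    IntegrableOn (fun u => b u ^ q / u) (Ioc s t) :=
  (hb.integrableOn_Ioi hq hs).mono_set Ioc_subset_Ioi_self

theorem lintegral_density_Ioi (hq : 0 < q) (hb : IsSV0 q b) {t : ℝ} (ht : 0 < t) :
    ∫⁻ u in Ioi t, density q b u = ENNReal.ofReal (tail q b t) := by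
  rw [tail, ofReal_integral_eq_lintegral_ofReal (hb.integrableOn_Ioi hq ht)]
  · rfl
  · filter_upwards [ae_restrict_mem measurableSet_Ioi] with u hu
    exact (hb.rpow_div_pos (ht.trans hu)).le

theorem tail_sub_tail (hq : 0 < q) (hb : IsSV0 q b) {s t : ℝ} (hs : 0 < s) (hst : s ≤ t) :
    tail q b s - tail q b t = ∫ u in s..t, b u ^ q / u :=
  intervalIntegral.integral_Ioi_sub_Ioi (hb.integrableOn_Ioi hq hs) hst

theorem lintegral_density_Ioc (hq : 0 < q) (hb : IsSV0 q b) {s t : ℝ} (hs : 0 < s) (hst : s ≤ t) :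
    ∫⁻ u in Ioc s t, density q b u = ENNReal.ofReal (tail q b s - tail q b t) := by
  rw [tail_sub_tail hq hb hs hst, intervalIntegral.integral_of_le hst,
    ofReal_integral_eq_lintegral_ofReal (hb.integrableOn_Ioc hq hs t)]
  · rfl
  · filter_upwards [ae_restrict_mem measurableSet_Ioc] with u hu
    exact (hb.rpow_div_pos (hs.trans hu.1)).le

theorem tail_strictAntiOn (hq : 0 < q) (hb : IsSV0 q b) : StrictAntiOn (tail q b) (Ioi 0) := by
  intro s hs t _ hst
  rw [← sub_pos, tail_sub_tail hq hb hs hst.le]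
  refine intervalIntegral.intervalIntegral_pos_of_pos_on ?_ (fun u hu => ?_) hst
  · rw [intervalIntegrable_iff_integrableOn_Ioc_of_le hst.le]
    exact hb.integrableOn_Ioc hq hs t
  · exact hb.rpow_div_pos (hs.trans hu.1)

theorem tail_nonneg (hb : IsSV0 q b) {t : ℝ} (ht : 0 < t) : 0 ≤ tail q b t :=
  setIntegral_nonneg measurableSet_Ioi fun _ hu => (hb.rpow_div_pos (ht.trans hu)).le

theorem tail_pos (hq : 0 < q) (hb : IsSV0 q b) {t : ℝ} (ht : 0 < t) : 0 < tail q b t :=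
  (tail_nonneg hb (ht.trans (lt_add_one t))).trans_lt
    (tail_strictAntiOn hq hb ht (ht.trans (lt_add_one t)) (lt_add_one t))

theorem tail_tendsto_atTop : Tendsto (tail q b) atTop (𝓝 0) := tendsto_integral_Ioi_zero tendsto_id

theorem absolutelyContinuousOnInterval_tail (hq : 0 < q) (hb : IsSV0 q b) {s t : ℝ} (hs : 0 < s)
    (hst : s ≤ t) : AbsolutelyContinuousOnInterval (tail q b) s t := by
  have hint : IntervalIntegrable (fun u => b u ^ q / u) volume s t :=
    (intervalIntegrable_iff_integrableOn_Ioc_of_le hst).2 (hb.integrableOn_Ioc hq hs t)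
  refine absolutelyContinuousOnInterval_of_dist_le (L := 1)
    (hint.absolutelyContinuousOnInterval_intervalIntegral (c := t) (by simp)) fun x hx y hy => ?_
  rw [uIcc_of_le hst] at hx hy
  rw [intervalIntegral.integral_symm, intervalIntegral.integral_symm y,
    ← tail_sub_tail hq hb (hs.trans_le hx.1) hx.2, ← tail_sub_tail hq hb (hs.trans_le hy.1) hy.2,
    dist_neg_neg, dist_sub_right, NNReal.coe_one, one_mul]

theorem continuousOn_tail (hq : 0 < q) (hb : IsSV0 q b) : ContinuousOn (tail q b) (Ioi 0) := by
  intro x (hx : 0 < x)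
  have h := (absolutelyContinuousOnInterval_tail hq hb (half_pos hx)
    (show x / 2 ≤ 2 * x by linarith)).continuousOn
  rw [uIcc_of_le (by linarith)] at h
  exact (h.continuousAt (Icc_mem_nhds (by linarith) (by linarith))).continuousWithinAt

theorem ae_hasDerivAt_tail (hq : 0 < q) (hb : IsSV0 q b) {s : ℝ} (hs : 0 < s) (t : ℝ) :
    ∀ᵐ x, x ∈ Ioc s t → HasDerivAt (tail q b) (-(b x ^ q / x)) x := by
  rcases le_total t s with hts | hst
  · simp [Ioc_eq_empty_of_le hts]
  have hst' : s ≤ t + 1 := hst.trans (lt_add_one t).le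
  have hint : IntervalIntegrable (fun u => b u ^ q / u) volume s (t + 1) :=
    (intervalIntegrable_iff_integrableOn_Ioc_of_le hst').2 (hb.integrableOn_Ioc hq hs _)
  filter_upwards [hint.ae_hasDerivAt_integral] with x hx hxst
  rw [uIcc_of_le hst'] at hx
  have hprim := hx ⟨hxst.1.le, by linarith [hxst.2]⟩ s ⟨le_rfl, hst'⟩
  refine (hprim.const_sub (tail q b s)).congr_of_eventuallyEq ?_
  filter_upwards [Ioi_mem_nhds hxst.1] with y hy
  rw [← tail_sub_tail hq hb hs (le_of_lt hy), sub_sub_cancel]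

theorem tailNorm_pos (hq : 0 < q) (hb : IsSV0 q b) {t : ℝ} (ht : 0 < t) : 0 < tailNorm q b t :=
  Real.rpow_pos_of_pos (tail_pos hq hb ht) _

theorem tailNorm_rpow (hq : 0 < q) (hb : IsSV0 q b) {t : ℝ} (ht : 0 < t) :
    tailNorm q b t ^ q = tail q b t := by
  rw [tailNorm, one_div, Real.rpow_inv_rpow (tail_nonneg hb ht) hq.ne']

theorem tailNorm_strictAntiOn (hq : 0 < q) (hb : IsSV0 q b) :
    StrictAntiOn (tailNorm q b) (Ioi 0) := fun _ hs _ ht hst =>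
  Real.rpow_lt_rpow (tail_nonneg hb ht) (tail_strictAntiOn hq hb hs ht hst) (by positivity)

theorem continuousOn_tailNorm (hq : 0 < q) (hb : IsSV0 q b) :
    ContinuousOn (tailNorm q b) (Ioi 0) :=
  (continuousOn_tail hq hb).rpow_const fun _ ht => Or.inl (tail_pos hq hb ht).ne'

theorem tailNorm_tendsto_atTop (hq : 0 < q) : Tendsto (tailNorm q b) atTop (𝓝 0) := by
  have h := (tail_tendsto_atTop (q := q) (b := b)).rpow_const (p := 1 / q) (Or.inr (by positivity))
  rwa [Real.zero_rpow (by positivity)] at h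

theorem ofReal_tailNorm_rpow (hq : 0 < q) (hb : IsSV0 q b) {t : ℝ} (ht : 0 < t) :
    ENNReal.ofReal (tailNorm q b t) ^ q = ENNReal.ofReal (tail q b t) := by
  rw [ENNReal.ofReal_rpow_of_pos (tailNorm_pos hq hb ht), tailNorm_rpow hq hb ht]

theorem exists_rpow_le_mul_tail (hq : 0 < q) (hb : IsSV0 q b) :
    ∃ D : ℝ, 0 < D ∧ ∀ t : ℝ, 0 < t → b t ^ q ≤ D * tail q b t := by
  obtain ⟨M, hM, h⟩ := hb.slowlyVarying.exists_le_mul_right one_pos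
  refine ⟨(M * 2) ^ q * 2, by positivity, fun t ht => ?_⟩
  have hlow (u : ℝ) (hu : u ∈ Ioc t (2 * t)) : b t ^ q / ((M * 2) ^ q * (2 * t)) ≤ b u ^ q / u := by
    have hu0 : 0 < u := ht.trans hu.1
    have hbt := (hb.pos ht).le
    have hbu : b t ≤ M * 2 * b u := by
      refine (h t u ht hu.1.le).trans ?_
      have := (hb.pos hu0).le
      rw [Real.rpow_one]
      gcongr
      exact (div_le_iff₀ ht).2 hu.2
    rw [← div_div, ← Real.div_rpow hbt (by positivity)]
    refine div_le_div₀ (Real.rpow_nonneg (hb.pos hu0).le q) ?_ hu0 hu.2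
    exact Real.rpow_le_rpow (by positivity) ((div_le_iff₀' (by positivity)).2 hbu) hq.le
  have hint : ENNReal.ofReal (b t ^ q / ((M * 2) ^ q * (2 * t))) * ENNReal.ofReal t ≤
      ENNReal.ofReal (tail q b t) :=
    calc _ = ∫⁻ _ in Ioc t (2 * t), ENNReal.ofReal (b t ^ q / ((M * 2) ^ q * (2 * t))) := by
          rw [setLIntegral_const, Real.volume_Ioc]
          ring_nf
      _ ≤ ∫⁻ u in Ioc t (2 * t), density q b u :=
          setLIntegral_mono' measurableSet_Ioc fun u hu => ENNReal.ofReal_le_ofReal (hlow u hu)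
      _ ≤ ∫⁻ u in Ioi t, density q b u := lintegral_mono_set Ioc_subset_Ioi_self
      _ = _ := lintegral_density_Ioi hq hb ht
  have hbt := hb.pos ht
  rw [← ENNReal.ofReal_mul (by positivity), ENNReal.ofReal_le_ofReal_iff (tail_nonneg hb ht),
    div_mul_eq_mul_div, div_le_iff₀ (by positivity)] at hint
  exact le_of_mul_le_mul_right (hint.trans_eq (by ring)) ht

theorem lintegral_Ioc_div_rpow_div {p : ℝ} (hp : 0 < p) {t : ℝ} (ht : 0 < t) :
    ∫⁻ s in Ioc 0 t, ENNReal.ofReal ((s / t) ^ p / s) = ENNReal.ofReal (1 / p) := by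
  have hp' : -1 < p - 1 := by linarith
  have hcongr : ∀ s ∈ Ioc 0 t,
      ENNReal.ofReal ((s / t) ^ p / s) = ENNReal.ofReal (s ^ (p - 1) * (t ^ p)⁻¹) := fun s hs => by
    rw [Real.div_rpow hs.1.le ht.le, Real.rpow_sub_one hs.1.ne']
    ring_nf
  have hint := intervalIntegral.intervalIntegrable_rpow' (a := 0) (b := t) hp'
  rw [setLIntegral_congr_fun measurableSet_Ioc hcongr, ← ofReal_integral_eq_lintegral_ofReal,
    integral_mul_const, ← intervalIntegral.integral_of_le ht.le, integral_rpow (Or.inl hp')]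
  · have := (Real.rpow_pos_of_pos ht p).ne'
    rw [sub_add_cancel, Real.zero_rpow hp.ne', sub_zero, div_mul_eq_mul_div, mul_inv_cancel₀ this]
  · exact ((intervalIntegrable_iff_integrableOn_Ioc_of_le ht.le).1 hint).mul_const _
  · filter_upwards [ae_restrict_mem measurableSet_Ioc] with s hs
    have := hs.1
    positivity

theorem exists_lintegral_density_mul_le (hq : 0 < q) (hb : IsSV0 q b) :
    ∃ C : ℝ≥0∞, C ≠ ∞ ∧ ∀ t : ℝ, 0 < t →
      ∫⁻ s in Ioc 0 t, density q b s * ENNReal.ofReal (s / t) ^ q ≤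
        C * ENNReal.ofReal (tailNorm q b t) ^ q := by
  obtain ⟨M, hM, h⟩ := hb.slowlyVarying.exists_le_mul_right (half_pos one_pos)
  obtain ⟨D, hD, hbD⟩ := exists_rpow_le_mul_tail hq hb
  refine ⟨ENNReal.ofReal (1 / (q / 2)) * ENNReal.ofReal (M ^ q * D), by finiteness,
    fun t ht => ?_⟩
  have hbt := hb.pos ht
  have hpt (s : ℝ) (hs : s ∈ Ioc 0 t) : density q b s * ENNReal.ofReal (s / t) ^ q ≤
      ENNReal.ofReal ((s / t) ^ (q / 2) / s) * ENNReal.ofReal (M ^ q * b t ^ q) := by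
    have hs0 : 0 < s := hs.1
    have hst : 0 < s / t := by positivity
    rw [density, ENNReal.ofReal_rpow_of_pos hst, ← ENNReal.ofReal_mul (hb.rpow_div_pos hs0).le,
      ← ENNReal.ofReal_mul (by positivity)]
    refine ENNReal.ofReal_le_ofReal ?_
    calc b s ^ q / s * (s / t) ^ q
        ≤ (M * (t / s) ^ (1 / 2 : ℝ) * b t) ^ q / s * (s / t) ^ q := by
          gcongr
          exacts [(hb.pos hs0).le, h s t hs0 hs.2]
      _ = (s / t) ^ (q / 2) / s * (M ^ q * b t ^ q) := by
          rw [Real.mul_rpow (by positivity) hbt.le, Real.mul_rpow hM.le (by positivity),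
            ← inv_div s t, ← Real.rpow_neg_eq_inv_rpow, ← Real.rpow_mul hst.le]
          have hexp : (s / t) ^ (-(1 / 2) * q) * (s / t) ^ q = (s / t) ^ (q / 2) := by
            rw [← Real.rpow_add hst]; ring_nf
          rw [← hexp]
          ring
  calc ∫⁻ s in Ioc 0 t, density q b s * ENNReal.ofReal (s / t) ^ q
      ≤ ∫⁻ s in Ioc 0 t, ENNReal.ofReal ((s / t) ^ (q / 2) / s) *
          ENNReal.ofReal (M ^ q * b t ^ q) := setLIntegral_mono' measurableSet_Ioc hpt
    _ = ENNReal.ofReal (1 / (q / 2)) * ENNReal.ofReal (M ^ q * b t ^ q) := by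
        rw [lintegral_mul_const' _ _ ENNReal.ofReal_ne_top,
          lintegral_Ioc_div_rpow_div (half_pos hq) ht]
    _ ≤ ENNReal.ofReal (1 / (q / 2)) * (ENNReal.ofReal (M ^ q * D * tail q b t)) := by
        gcongr _ * ENNReal.ofReal ?_
        rw [mul_assoc]
        gcongr
        exact hbD t ht
    _ = _ := by
        rw [ENNReal.ofReal_mul (by positivity), ofReal_tailNorm_rpow hq hb ht, mul_assoc]

end Tail

section Growth

theorem EquivNondecreasing.congr {F G : ℝ → ℝ} (hF : EquivNondecreasing F)
    (h : EqOn F G (Ioi 0)) : EquivNondecreasing G := by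
  obtain ⟨g, hg, c, C, hc, hC, hgF⟩ := hF
  exact ⟨g, hg, c, C, hc, hC, fun t ht => h ht ▸ hgF t ht⟩

theorem EquivNondecreasing.of_monotoneOn {F : ℝ → ℝ} (hF : MonotoneOn F (Ioi 0)) :
    EquivNondecreasing F :=
  ⟨F, hF, 1, 1, one_pos, one_pos, fun _ _ => by simp⟩

theorem EquivNondecreasing.rpow {F : ℝ → ℝ} (hF : EquivNondecreasing F)
    (hpos : ∀ t, 0 < t → 0 < F t) {p : ℝ} (hp : 0 ≤ p) :
    EquivNondecreasing fun t => F t ^ p := by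
  obtain ⟨g, hg, c, C, hc, hC, hgF⟩ := hF
  have hg_pos (t : ℝ) (ht : 0 < t) : 0 < g t :=
    pos_of_mul_pos_right ((hpos t ht).trans_le (hgF t ht).2) hC.le
  refine ⟨fun t => g t ^ p, fun s hs t ht hst => ?_, c ^ p, C ^ p, by positivity, by positivity,
    fun t ht => ?_⟩
  · exact Real.rpow_le_rpow (hg_pos s hs).le (hg hs ht hst) hp
  · rw [← Real.mul_rpow hc.le (hg_pos t ht).le, ← Real.mul_rpow hC.le (hg_pos t ht).le]
    have hcg := mul_pos hc (hg_pos t ht)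
    exact ⟨Real.rpow_le_rpow hcg.le (hgF t ht).1 hp,
      Real.rpow_le_rpow (hpos t ht).le (hgF t ht).2 hp⟩

variable {q₀ q₁ : ℝ} {b₀ b₁ : ℝ → ℝ}

theorem rho_pos (hq₀ : 0 < q₀) (hq₁ : 0 < q₁) (hb₀ : IsSV0 q₀ b₀) (hb₁ : IsSV0 q₁ b₁)
    {t : ℝ} (ht : 0 < t) : 0 < rho q₀ q₁ b₀ b₁ t :=
  div_pos (tailNorm_pos hq₀ hb₀ ht) (tailNorm_pos hq₁ hb₁ ht)

theorem rho_mul_tailNorm (hq₁ : 0 < q₁) (hb₁ : IsSV0 q₁ b₁) {t : ℝ} (ht : 0 < t) :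
    rho q₀ q₁ b₀ b₁ t * tailNorm q₁ b₁ t = tailNorm q₀ b₀ t :=
  div_mul_cancel₀ _ (tailNorm_pos hq₁ hb₁ ht).ne'

theorem log_rho (hq₀ : 0 < q₀) (hq₁ : 0 < q₁) (hb₀ : IsSV0 q₀ b₀) (hb₁ : IsSV0 q₁ b₁)
    {t : ℝ} (ht : 0 < t) : Real.log (rho q₀ q₁ b₀ b₁ t) =
      1 / q₀ * Real.log (tail q₀ b₀ t) - 1 / q₁ * Real.log (tail q₁ b₁ t) := by
  rw [rho, Real.log_div (tailNorm_pos hq₀ hb₀ ht).ne' (tailNorm_pos hq₁ hb₁ ht).ne', tailNorm,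
    tailNorm, Real.log_rpow (tail_pos hq₀ hb₀ ht), Real.log_rpow (tail_pos hq₁ hb₁ ht)]

theorem monotoneOn_rho_mul_tail_rpow (hq₀ : 0 < q₀) (hq₁ : 0 < q₁) (hb₀ : IsSV0 q₀ b₀)
    (hb₁ : IsSV0 q₁ b₁) {c : ℝ} (h : ∀ᵐ t ∂(volume.restrict (Ioi (0 : ℝ))),
      c * (t⁻¹ * b₁ t ^ q₁ / tail q₁ b₁ t) ≤ deriv (rho q₀ q₁ b₀ b₁) t / rho q₀ q₁ b₀ b₁ t) :
    MonotoneOn (fun t => rho q₀ q₁ b₀ b₁ t * tail q₁ b₁ t ^ c) (Ioi 0) := by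
  set L : ℝ → ℝ := fun t =>
    1 / q₀ * Real.log (tail q₀ b₀ t) + (c - 1 / q₁) * Real.log (tail q₁ b₁ t) with hL
  have hlog {t : ℝ} (ht : 0 < t) : L t =
      Real.log (rho q₀ q₁ b₀ b₁ t) + c * Real.log (tail q₁ b₁ t) := by
    rw [log_rho hq₀ hq₁ hb₀ hb₁ ht, hL]
    ring
  intro s (hs : 0 < s) t (ht : 0 < t) hst
  have hL_ac : AbsolutelyContinuousOnInterval L s t := by
    have hpos {x : ℝ} (hx : x ∈ uIcc s t) : 0 < x := hs.trans_le (uIcc_of_le hst ▸ hx).1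
    exact ((absolutelyContinuousOnInterval_log (absolutelyContinuousOnInterval_tail hq₀ hb₀ hs hst)
      fun x hx => tail_pos hq₀ hb₀ (hpos hx)).const_mul _).add
      ((absolutelyContinuousOnInterval_log (absolutelyContinuousOnInterval_tail hq₁ hb₁ hs hst)
      fun x hx => tail_pos hq₁ hb₁ (hpos hx)).const_mul _)
  have hL_deriv : ∀ᵐ x, x ∈ Ioc s t → 0 ≤ deriv L x := by
    filter_upwards [ae_hasDerivAt_tail hq₀ hb₀ hs t, ae_hasDerivAt_tail hq₁ hb₁ hs t,
      (ae_restrict_iff' measurableSet_Ioi).1 h] with x h₀ h₁ hx hxst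
    have hx0 : 0 < x := hs.trans hxst.1
    have hρ' : DifferentiableAt ℝ (rho q₀ q₁ b₀ b₁) x :=
      ((h₀ hxst).differentiableAt.rpow_const (Or.inl (tail_pos hq₀ hb₀ hx0).ne')).div
        ((h₁ hxst).differentiableAt.rpow_const (Or.inl (tail_pos hq₁ hb₁ hx0).ne'))
        (tailNorm_pos hq₁ hb₁ hx0).ne'
    have hL' := ((hρ'.hasDerivAt.log (rho_pos hq₀ hq₁ hb₀ hb₁ hx0).ne').add
      (((h₁ hxst).log (tail_pos hq₁ hb₁ hx0).ne').const_mul c)).congr_of_eventuallyEq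
      (f₁ := L) (by filter_upwards [Ioi_mem_nhds hx0] with y hy using hlog hy)
    rw [hL'.deriv, neg_div, mul_neg, ← sub_eq_add_neg, sub_nonneg, div_eq_inv_mul (b₁ x ^ q₁)]
    exact hx hx0
  have hexp {x : ℝ} (hx : 0 < x) : rho q₀ q₁ b₀ b₁ x * tail q₁ b₁ x ^ c = Real.exp (L x) := by
    rw [hlog hx, Real.exp_add, Real.exp_log (rho_pos hq₀ hq₁ hb₀ hb₁ hx), mul_comm c,
      Real.rpow_def_of_pos (tail_pos hq₁ hb₁ hx)]
  simp only [hexp hs, hexp ht, Real.exp_le_exp]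
  exact le_of_ae_deriv_nonneg hL_ac hst hL_deriv

theorem exists_equivNondecreasing_of_deriv_rho (hq₀ : 0 < q₀) (hq₁ : 0 < q₁) (hb₀ : IsSV0 q₀ b₀)
    (hb₁ : IsSV0 q₁ b₁) {c : ℝ} (hc : 0 < c) (h : ∀ᵐ t ∂(volume.restrict (Ioi (0 : ℝ))),
      c * (t⁻¹ * b₁ t ^ q₁ / tail q₁ b₁ t) ≤ deriv (rho q₀ q₁ b₀ b₁) t / rho q₀ q₁ b₀ b₁ t) :
    ∃ α : ℝ, 0 < α ∧ EquivNondecreasing fun t => rho q₀ q₁ b₀ b₁ t * tailNorm q₁ b₁ t ^ α := by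
  refine ⟨q₁ * c, by positivity, (EquivNondecreasing.of_monotoneOn
    (monotoneOn_rho_mul_tail_rpow hq₀ hq₁ hb₀ hb₁ h)).congr fun t ht => ?_⟩
  simp only [Real.rpow_mul (tailNorm_pos hq₁ hb₁ ht).le, tailNorm_rpow hq₁ hb₁ ht]

theorem exists_equivNondecreasing_of_rhoEps (hq₀ : 0 < q₀) (hq₁ : 0 < q₁) (hb₀ : IsSV0 q₀ b₀)
    (hb₁ : IsSV0 q₁ b₁) {ε : ℝ} (hε : 0 < ε)
    (h : EquivNondecreasing (rhoEps ε q₀ q₁ b₀ b₁)) :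
    ∃ α : ℝ, 0 < α ∧ EquivNondecreasing fun t => rho q₀ q₁ b₀ b₁ t * tailNorm q₁ b₁ t ^ α := by
  have hpos (t : ℝ) (ht : 0 < t) : 0 < rhoEps ε q₀ q₁ b₀ b₁ t :=
    div_pos (Real.rpow_pos_of_pos (tailNorm_pos hq₀ hb₀ ht) _) (tailNorm_pos hq₁ hb₁ ht)
  refine ⟨ε * (1 + ε)⁻¹, by positivity,
    (h.rpow hpos (inv_nonneg.2 (by positivity : 0 ≤ 1 + ε))).congr fun t (ht : 0 < t) => ?_⟩
  have hn := tailNorm_pos hq₁ hb₁ ht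
  have hρ := rho_pos hq₀ hq₁ hb₀ hb₁ ht
  have hε1 : 1 + ε ≠ 0 := by positivity
  have hrhoEps : rhoEps ε q₀ q₁ b₀ b₁ t = rho q₀ q₁ b₀ b₁ t ^ (1 + ε) * tailNorm q₁ b₁ t ^ ε := by
    rw [rhoEps, ← rho_mul_tailNorm hq₁ hb₁ ht, Real.mul_rpow hρ.le hn.le,
      Real.rpow_add hn 1 ε, Real.rpow_one]
    field_simp
  simp only [hrhoEps, Real.mul_rpow (Real.rpow_nonneg hρ.le _) (Real.rpow_nonneg hn.le _),
    Real.rpow_rpow_inv hρ.le hε1, Real.rpow_mul hn.le]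

end Growth

section WeightedNorm

/-- The quasi-norm of `F` in `L^q(S; b(u)^q du/u)`. The two sides of Holmstedt's formula are
expressed through it with `S = (0,t)` and `S = (t,∞)`. -/
noncomputable def weightedNorm (q : ℝ) (b : ℝ → ℝ) (S : Set ℝ) (F : ℝ → ℝ≥0∞) : ℝ≥0∞ :=
  (∫⁻ s in S, density q b s * F s ^ q) ^ (1 / q)

variable {q : ℝ} {b : ℝ → ℝ} {S : Set ℝ} {F G : ℝ → ℝ≥0∞}

theorem weightedNorm_rpow (hq : 0 < q) :
    weightedNorm q b S F ^ q = ∫⁻ s in S, density q b s * F s ^ q := by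
  rw [weightedNorm, ← ENNReal.rpow_mul, one_div_mul_cancel hq.ne', ENNReal.rpow_one]

theorem interpNorm_zero_eq_weightedNorm {V : Type*} [AddCommGroup V] {N₀ N₁ : V → ℝ≥0∞}
    (hq : 0 < q) (hb : ∀ t, 0 < t → 0 < b t) (f : V) :
    interpNorm N₀ N₁ 0 q b f = weightedNorm q b (Ioi 0) fun t => KFun N₀ N₁ t f := by
  refine (ENNReal.rpow_left_injective hq.ne') ?_
  simp only [interpNorm_rpow hq hb, weightedNorm_rpow hq, neg_zero, Real.rpow_zero, one_mul]

theorem weightedNorm_mono (hq : 0 ≤ q) (hS : MeasurableSet S) (h : ∀ s ∈ S, F s ≤ G s) :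
    weightedNorm q b S F ≤ weightedNorm q b S G :=
  ENNReal.rpow_le_rpow (setLIntegral_mono' hS fun s hs => by gcongr; exact h s hs) (by positivity)

theorem weightedNorm_mono_set (hq : 0 ≤ q) {S' : Set ℝ} (h : S ⊆ S') :
    weightedNorm q b S F ≤ weightedNorm q b S' F :=
  ENNReal.rpow_le_rpow (lintegral_mono_set h) (by positivity)

theorem weightedNorm_indicator (hq : 0 < q) (hS : MeasurableSet S) {S' : Set ℝ} (h : S ⊆ S') :
    weightedNorm q b S' (S.indicator F) = weightedNorm q b S F := by
  have hpow (s : ℝ) : density q b s * S.indicator F s ^ q =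
      S.indicator (fun s => density q b s * F s ^ q) s := by
    by_cases hs : s ∈ S <;> simp [hs, hq]
  simp only [weightedNorm, hpow, lintegral_indicator hS, Measure.restrict_restrict hS,
    inter_eq_left.2 h]

theorem IsSV0.aemeasurable_density_mul (hb : IsSV0 q b) (hS : S ⊆ Ioi 0) (hF : Measurable F) :
    AEMeasurable (fun s => density q b s * F s ^ q) (volume.restrict S) :=
  ((hb.aemeasurable_rpow_div.mono_measure (Measure.restrict_mono hS le_rfl)).ennreal_ofReal).mul
    (hF.pow_const q).aemeasurable

theorem weightedNorm_mul_const (hq : 0 < q) (hb : IsSV0 q b) (hS : S ⊆ Ioi 0) (hF : Measurable F)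
    (a : ℝ≥0∞) : weightedNorm q b S (fun s => F s * a) = weightedNorm q b S F * a := by
  have hint : ∫⁻ s in S, density q b s * (F s * a) ^ q =
      (∫⁻ s in S, density q b s * F s ^ q) * a ^ q := by
    rw [← lintegral_mul_const'' _ (hb.aemeasurable_density_mul hS hF)]
    simp only [ENNReal.mul_rpow_of_nonneg _ _ hq.le, mul_assoc]
  rw [weightedNorm, hint, ENNReal.mul_rpow_of_nonneg _ _ (by positivity), ← ENNReal.rpow_mul a,
    mul_one_div_cancel hq.ne', ENNReal.rpow_one, weightedNorm]

theorem weightedNorm_const_Ioi (hq : 0 < q) (hb : IsSV0 q b) {t : ℝ} (ht : 0 < t) (a : ℝ≥0∞) :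
    weightedNorm q b (Ioi t) (fun _ => a) = ENNReal.ofReal (tailNorm q b t) * a := by
  have h := weightedNorm_mul_const hq hb (Ioi_subset_Ioi ht.le) (measurable_const (a := 1)) a
  have hone : weightedNorm q b (Ioi t) (fun _ => 1) = ENNReal.ofReal (tailNorm q b t) := by
    refine (ENNReal.rpow_left_injective hq.ne') ?_
    simp only [weightedNorm_rpow hq, ENNReal.one_rpow, mul_one, lintegral_density_Ioi hq hb ht,
      ofReal_tailNorm_rpow hq hb ht]
  simpa only [one_mul, hone] using h

theorem weightedNorm_add_le (hq : 0 < q) (hb : IsSV0 q b) (hS : S ⊆ Ioi 0) (hF : Measurable F) :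
    weightedNorm q b S (fun s => F s + G s) ≤
      2 * 2 ^ (1 / q) * (weightedNorm q b S F + weightedNorm q b S G) := by
  have hint : ∫⁻ s in S, density q b s * (F s + G s) ^ q ≤
      2 ^ q * ((∫⁻ s in S, density q b s * F s ^ q) + ∫⁻ s in S, density q b s * G s ^ q) := by
    rw [← lintegral_add_left' (hb.aemeasurable_density_mul hS hF),
      ← lintegral_const_mul' _ _ (by finiteness)]
    refine lintegral_mono fun s => ?_
    rw [← mul_add, mul_left_comm]
    gcongr
    exact ENNReal.add_rpow_le_two_rpow_mul_rpow_add_rpow _ _ hq.le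
  calc weightedNorm q b S (fun s => F s + G s)
      ≤ (2 ^ q * ((∫⁻ s in S, density q b s * F s ^ q) +
          ∫⁻ s in S, density q b s * G s ^ q)) ^ (1 / q) :=
        ENNReal.rpow_le_rpow hint (by positivity)
    _ = 2 * ((∫⁻ s in S, density q b s * F s ^ q) +
          ∫⁻ s in S, density q b s * G s ^ q) ^ (1 / q) := by
        rw [ENNReal.mul_rpow_of_nonneg _ _ (by positivity), ← ENNReal.rpow_mul,
          mul_one_div_cancel hq.ne', ENNReal.rpow_one]
    _ ≤ 2 * (2 ^ (1 / q) * (weightedNorm q b S F + weightedNorm q b S G)) := by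
        gcongr
        exact ENNReal.add_rpow_le_two_rpow_mul_rpow_add_rpow _ _ (one_div_nonneg.2 hq.le)
    _ = _ := by ring

theorem exists_weightedNorm_min_le (hq : 0 < q) (hb : IsSV0 q b) :
    ∃ C : ℝ≥0∞, C ≠ ∞ ∧ ∀ t : ℝ, 0 < t →
      weightedNorm q b (Ioi 0) (fun s => min 1 (ENNReal.ofReal (s / t))) ≤
        C * ENNReal.ofReal (tailNorm q b t) := by
  obtain ⟨C, hC, h⟩ := exists_lintegral_density_mul_le hq hb
  refine ⟨(C + 1) ^ (1 / q), by finiteness, fun t ht => ?_⟩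
  set n := ENNReal.ofReal (tailNorm q b t)
  have hn : n = (n ^ q) ^ (1 / q) := by
    rw [← ENNReal.rpow_mul, mul_one_div_cancel hq.ne', ENNReal.rpow_one]
  rw [hn, ← ENNReal.mul_rpow_of_nonneg _ _ (by positivity), add_mul, one_mul]
  refine ENNReal.rpow_le_rpow ?_ (by positivity)
  rw [← Ioc_union_Ioi_eq_Ioi ht.le]
  refine (lintegral_union_le _ _ _).trans (add_le_add ?_ ?_)
  · exact (lintegral_mono fun s => by gcongr; exact min_le_right _ _).trans (h t ht)
  · rw [ofReal_tailNorm_rpow hq hb ht, ← lintegral_density_Ioi hq hb ht]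
    refine lintegral_mono fun s => mul_le_of_le_one_right' ?_
    exact ENNReal.rpow_le_one (min_le_left _ _) hq.le

end WeightedNorm

section Holmstedt

variable {V : Type*} [AddCommGroup V] {N₀ N₁ : V → ℝ≥0∞}

theorem measurable_KFun (f : V) : Measurable fun t => KFun N₀ N₁ t f := (KFun_mono f).measurable

theorem KFun_le_div_mul (h₀ : N₀ 0 = 0) (x : V) (s : ℝ) {t : ℝ} (ht : 0 < t) :
    KFun N₀ N₁ s x ≤ ENNReal.ofReal (s / t) * (ENNReal.ofReal t * N₁ x) := by
  rw [← mul_assoc, ← ENNReal.ofReal_mul' ht.le, div_mul_cancel₀ _ ht.ne']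
  exact KFun_le_right h₀ s x

variable {q : ℝ} {b : ℝ → ℝ}

theorem tailNorm_mul_KFun_le (hq : 0 < q) (hb : IsSV0 q b) {t : ℝ} (ht : 0 < t) (f : V) :
    ENNReal.ofReal (tailNorm q b t) * KFun N₀ N₁ t f ≤
      weightedNorm q b (Ioi t) fun s => KFun N₀ N₁ s f := by
  rw [← weightedNorm_const_Ioi hq hb ht]
  exact weightedNorm_mono hq.le measurableSet_Ioi fun s hs => KFun_mono f (le_of_lt hs)

theorem exists_interpNorm_le_of_KFun_le (N₀ N₁ : V → ℝ≥0∞) (hq : 0 < q) (hb : IsSV0 q b)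
    {K : ℝ≥0∞} (hK : K ≠ ∞) :
    ∃ C : ℝ≥0∞, C ≠ ∞ ∧ ∀ (t : ℝ), 0 < t → ∀ (f x : V) (a : ℝ≥0∞) (S : Set ℝ),
      MeasurableSet S → S ⊆ Ioi 0 → (∀ s, 0 < s → KFun N₀ N₁ s x ≤
        K * (S.indicator (fun s => KFun N₀ N₁ s f) s + min 1 (ENNReal.ofReal (s / t)) * a)) →
      interpNorm N₀ N₁ 0 q b x ≤ C * (weightedNorm q b S (fun s => KFun N₀ N₁ s f) +
        ENNReal.ofReal (tailNorm q b t) * a) := by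
  obtain ⟨C, hC, hmin⟩ := exists_weightedNorm_min_le hq hb
  refine ⟨2 * 2 ^ (1 / q) * (C + 1) * K, by finiteness, fun t ht f x a S hS hS0 hx => ?_⟩
  have hind : Measurable (S.indicator fun s => KFun N₀ N₁ s f) := (measurable_KFun f).indicator hS
  have hmeas : Measurable fun s : ℝ => min 1 (ENNReal.ofReal (s / t)) := by fun_prop
  rw [interpNorm_zero_eq_weightedNorm hq (fun _ => hb.pos)]
  calc weightedNorm q b (Ioi 0) (fun s => KFun N₀ N₁ s x)
      ≤ weightedNorm q b (Ioi 0) (fun s => (S.indicator (fun s => KFun N₀ N₁ s f) s +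
          min 1 (ENNReal.ofReal (s / t)) * a) * K) :=
        weightedNorm_mono hq.le measurableSet_Ioi fun s hs => (hx s hs).trans_eq (mul_comm _ _)
    _ = weightedNorm q b (Ioi 0) (fun s => S.indicator (fun s => KFun N₀ N₁ s f) s +
          min 1 (ENNReal.ofReal (s / t)) * a) * K :=
        weightedNorm_mul_const hq hb subset_rfl (hind.add (hmeas.mul_const a)) K
    _ ≤ 2 * 2 ^ (1 / q) * (weightedNorm q b S (fun s => KFun N₀ N₁ s f) +
          C * ENNReal.ofReal (tailNorm q b t) * a) * K := by
        gcongr ?_ * K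
        refine (weightedNorm_add_le hq hb subset_rfl hind).trans ?_
        rw [weightedNorm_indicator hq hS hS0, weightedNorm_mul_const hq hb subset_rfl hmeas]
        gcongr
        exact hmin t ht
    _ ≤ 2 * 2 ^ (1 / q) * ((C + 1) * (weightedNorm q b S (fun s => KFun N₀ N₁ s f) +
          ENNReal.ofReal (tailNorm q b t) * a)) * K := by
        rw [mul_add (C + 1), mul_assoc C]
        gcongr
        exacts [le_mul_of_one_le_left' le_add_self, le_self_add]
    _ = _ := by ring

theorem exists_interpNorm_left_le (h₀ : IsQuasiSeminorm N₀) (h₁ : IsQuasiSeminorm N₁) (hq : 0 < q)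
    (hb : IsSV0 q b) : ∃ C : ℝ≥0∞, C ≠ ∞ ∧ ∀ (t : ℝ), 0 < t → ∀ f f₀ f₁ : V, f₀ + f₁ = f →
      interpNorm N₀ N₁ 0 q b f₀ ≤
        C * (weightedNorm q b (Ioc 0 t) (fun s => KFun N₀ N₁ s f) +
          ENNReal.ofReal (tailNorm q b t) * (N₀ f₀ + ENNReal.ofReal t * N₁ f₁)) := by
  obtain ⟨D, hD, hsub⟩ := exists_KFun_sub_le h₀ h₁
  obtain ⟨C, hC, h⟩ := exists_interpNorm_le_of_KFun_le N₀ N₁ hq hb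
    (ENNReal.add_ne_top.2 ⟨hD, ENNReal.one_ne_top⟩)
  refine ⟨C, hC, fun t ht f f₀ f₁ hf => h t ht f f₀ _ _ measurableSet_Ioc
    Ioc_subset_Ioi_self fun s hs => ?_⟩
  rcases le_or_gt s t with hst | hst
  · have hle : ENNReal.ofReal (s / t) ≤ 1 := ENNReal.ofReal_le_one.2 ((div_le_one ht).2 hst)
    rw [indicator_of_mem (show s ∈ Ioc 0 t from ⟨hs, hst⟩), min_eq_right hle]
    calc KFun N₀ N₁ s f₀ = KFun N₀ N₁ s (f - f₁) := by rw [← hf, add_sub_cancel_right]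
      _ ≤ D * (KFun N₀ N₁ s f + KFun N₀ N₁ s f₁) := hsub s _ _
      _ ≤ (D + 1) * _ := by
        gcongr
        exacts [le_self_add,
          (KFun_le_div_mul h₀.map_zero f₁ s ht).trans (by gcongr; exact le_add_self)]
  · have hle : 1 ≤ ENNReal.ofReal (s / t) := ENNReal.one_le_ofReal.2 ((one_le_div ht).2 hst.le)
    rw [indicator_of_notMem (fun h => hst.not_ge h.2), min_eq_left hle, zero_add, one_mul]
    exact (KFun_le_left h₁.map_zero s f₀).trans
      (le_self_add.trans (le_mul_of_one_le_left' le_add_self))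

theorem exists_interpNorm_right_le (h₀ : IsQuasiSeminorm N₀) (h₁ : IsQuasiSeminorm N₁) (hq : 0 < q)
    (hb : IsSV0 q b) : ∃ C : ℝ≥0∞, C ≠ ∞ ∧ ∀ (t : ℝ), 0 < t → ∀ f f₀ f₁ : V, f₀ + f₁ = f →
      interpNorm N₀ N₁ 0 q b f₁ ≤
        C * (weightedNorm q b (Ioi t) (fun s => KFun N₀ N₁ s f) +
          ENNReal.ofReal (tailNorm q b t) * (N₀ f₀ + ENNReal.ofReal t * N₁ f₁)) := by
  obtain ⟨D, hD, hsub⟩ := exists_KFun_sub_le h₀ h₁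
  obtain ⟨C, hC, h⟩ := exists_interpNorm_le_of_KFun_le N₀ N₁ hq hb
    (ENNReal.add_ne_top.2 ⟨hD, ENNReal.one_ne_top⟩)
  refine ⟨C, hC, fun t ht f f₀ f₁ hf => h t ht f f₁ _ _ measurableSet_Ioi
    (Ioi_subset_Ioi ht.le) fun s _ => ?_⟩
  rcases le_or_gt s t with hst | hst
  · have hle : ENNReal.ofReal (s / t) ≤ 1 := ENNReal.ofReal_le_one.2 ((div_le_one ht).2 hst)
    rw [indicator_of_notMem (show s ∉ Ioi t from hst.not_gt), min_eq_right hle, zero_add]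
    exact (KFun_le_div_mul h₀.map_zero f₁ s ht).trans
      ((mul_le_mul_right le_add_self _).trans (le_mul_of_one_le_left' le_add_self))
  · have hle : 1 ≤ ENNReal.ofReal (s / t) := ENNReal.one_le_ofReal.2 ((one_le_div ht).2 hst.le)
    rw [indicator_of_mem (show s ∈ Ioi t from hst), min_eq_left hle, one_mul]
    calc KFun N₀ N₁ s f₁ = KFun N₀ N₁ s (f - f₀) := by rw [← hf, add_sub_cancel_left]
      _ ≤ D * (KFun N₀ N₁ s f + KFun N₀ N₁ s f₀) := hsub s _ _
      _ ≤ (D + 1) * _ := by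
        gcongr
        exacts [le_self_add, (KFun_le_left h₁.map_zero s f₀).trans le_self_add]

variable {q₀ q₁ : ℝ} {b₀ b₁ : ℝ → ℝ}

theorem ofReal_rho_mul_tailNorm (hq₁ : 0 < q₁) (hb₁ : IsSV0 q₁ b₁) {t : ℝ} (ht : 0 < t) :
    ENNReal.ofReal (rho q₀ q₁ b₀ b₁ t) * ENNReal.ofReal (tailNorm q₁ b₁ t) =
      ENNReal.ofReal (tailNorm q₀ b₀ t) := by
  rw [← ENNReal.ofReal_mul' (tailNorm_pos hq₁ hb₁ ht).le, rho_mul_tailNorm hq₁ hb₁ ht]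

theorem exists_tailNorm_mul_KFun_le (h₀ : IsQuasiSeminorm N₀) (h₁ : IsQuasiSeminorm N₁)
    (hq₀ : 0 < q₀) (hq₁ : 0 < q₁) (hb₀ : IsSV0 q₀ b₀) (hb₁ : IsSV0 q₁ b₁) :
    ∃ C : ℝ≥0∞, C ≠ ∞ ∧ ∀ (t : ℝ), 0 < t → ∀ f : V,
      ENNReal.ofReal (tailNorm q₀ b₀ t) * KFun N₀ N₁ t f ≤
        C * KFun (interpNorm N₀ N₁ 0 q₀ b₀) (interpNorm N₀ N₁ 0 q₁ b₁) (rho q₀ q₁ b₀ b₁ t) f := by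
  obtain ⟨C, hC0, hC, hadd⟩ := exists_KFun_add_le h₀ h₁
  refine ⟨C, hC, fun t ht f => ?_⟩
  have hle {q : ℝ} {b : ℝ → ℝ} (hq : 0 < q) (hb : IsSV0 q b) (g : V) :
      ENNReal.ofReal (tailNorm q b t) * KFun N₀ N₁ t g ≤ interpNorm N₀ N₁ 0 q b g := by
    rw [interpNorm_zero_eq_weightedNorm hq fun _ => hb.pos]
    exact (tailNorm_mul_KFun_le hq hb ht g).trans
      (weightedNorm_mono_set hq.le (Ioi_subset_Ioi ht.le))
  refine (le_add_mul_KFun (b := 0) hC0 hC fun f₀ f₁ hf => ?_).trans_eq (zero_add _)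
  rw [zero_add]
  calc ENNReal.ofReal (tailNorm q₀ b₀ t) * KFun N₀ N₁ t f
      ≤ ENNReal.ofReal (tailNorm q₀ b₀ t) * (C * (KFun N₀ N₁ t f₀ + KFun N₀ N₁ t f₁)) := by
        gcongr
        exact hf ▸ hadd t f₀ f₁
    _ = C * (ENNReal.ofReal (tailNorm q₀ b₀ t) * KFun N₀ N₁ t f₀ +
          ENNReal.ofReal (rho q₀ q₁ b₀ b₁ t) *
            (ENNReal.ofReal (tailNorm q₁ b₁ t) * KFun N₀ N₁ t f₁)) := by
        rw [← mul_assoc (ENNReal.ofReal (rho _ _ _ _ _)), ofReal_rho_mul_tailNorm hq₁ hb₁ ht]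
        ring
    _ ≤ _ := by
        gcongr
        exacts [hle hq₀ hb₀ f₀, hle hq₁ hb₁ f₁]

theorem exists_KFun_interpNorm_le (h₀ : IsQuasiSeminorm N₀) (h₁ : IsQuasiSeminorm N₁)
    (hq₀ : 0 < q₀) (hq₁ : 0 < q₁) (hb₀ : IsSV0 q₀ b₀) (hb₁ : IsSV0 q₁ b₁) :
    ∃ C : ℝ≥0∞, C ≠ ∞ ∧ ∀ (t : ℝ), 0 < t → ∀ f : V,
      KFun (interpNorm N₀ N₁ 0 q₀ b₀) (interpNorm N₀ N₁ 0 q₁ b₁) (rho q₀ q₁ b₀ b₁ t) f ≤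
        C * (weightedNorm q₀ b₀ (Ioc 0 t) (fun s => KFun N₀ N₁ s f) +
          ENNReal.ofReal (rho q₀ q₁ b₀ b₁ t) *
            weightedNorm q₁ b₁ (Ioi t) fun s => KFun N₀ N₁ s f) := by
  obtain ⟨C₀, hC₀, hleft⟩ := exists_interpNorm_left_le h₀ h₁ hq₀ hb₀
  obtain ⟨C₁, hC₁, hright⟩ := exists_interpNorm_right_le h₀ h₁ hq₁ hb₁
  refine ⟨2 * (C₀ + C₁ + 1), by finiteness, fun t ht f => ?_⟩
  set I := weightedNorm q₀ b₀ (Ioc 0 t) fun s => KFun N₀ N₁ s f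
  set J := weightedNorm q₁ b₁ (Ioi t) fun s => KFun N₀ N₁ s f
  set ρ := ENNReal.ofReal (rho q₀ q₁ b₀ b₁ t)
  set n₀ := ENNReal.ofReal (tailNorm q₀ b₀ t)
  set n₁ := ENNReal.ofReal (tailNorm q₁ b₁ t)
  have hρn : ρ * n₁ = n₀ := ofReal_rho_mul_tailNorm hq₁ hb₁ ht
  have hn₀ : n₀ ≠ 0 := (ENNReal.ofReal_pos.2 (tailNorm_pos hq₀ hb₀ ht)).ne'
  have hupper : KFun (interpNorm N₀ N₁ 0 q₀ b₀) (interpNorm N₀ N₁ 0 q₁ b₁)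
      (rho q₀ q₁ b₀ b₁ t) f ≤
        (C₀ + C₁ + 1) * (I + ρ * J) + (C₀ + C₁ + 1) * n₀ * KFun N₀ N₁ t f := by
    refine le_add_mul_KFun (by simp [hn₀]) (by finiteness) fun f₀ f₁ hf => ?_
    set a := N₀ f₀ + ENNReal.ofReal t * N₁ f₁
    calc _ ≤ interpNorm N₀ N₁ 0 q₀ b₀ f₀ + ρ * interpNorm N₀ N₁ 0 q₁ b₁ f₁ := KFun_le hf _
      _ ≤ C₀ * (I + n₀ * a) + ρ * (C₁ * (J + n₁ * a)) := by
        gcongr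
        exacts [hleft t ht f f₀ f₁ hf, hright t ht f f₀ f₁ hf]
      _ = C₀ * I + C₁ * (ρ * J) + (C₀ + C₁) * (ρ * n₁) * a := by
        rw [← hρn]
        ring
      _ ≤ (C₀ + C₁ + 1) * I + (C₀ + C₁ + 1) * (ρ * J) + (C₀ + C₁ + 1) * n₀ * a := by
        rw [hρn]
        gcongr ?_ * _ + ?_ * _ + ?_ * _ * _
        exacts [le_self_add.trans le_self_add, le_add_self.trans le_self_add, le_self_add]
      _ = _ := by ring
  have hnK : n₀ * KFun N₀ N₁ t f ≤ I + ρ * J := by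
    rw [← hρn, mul_assoc]
    exact le_add_left (by gcongr; exact tailNorm_mul_KFun_le hq₁ hb₁ ht f)
  calc _ ≤ (C₀ + C₁ + 1) * (I + ρ * J) + (C₀ + C₁ + 1) * (n₀ * KFun N₀ N₁ t f) :=
        hupper.trans_eq (by ring)
    _ ≤ (C₀ + C₁ + 1) * (I + ρ * J) + (C₀ + C₁ + 1) * (I + ρ * J) := by gcongr
    _ = _ := by ring

end Holmstedt

section Hardy

variable {p q : ℝ} {r : ℝ≥0∞}

theorem pow_rpow_comm (η : ℝ≥0∞) (i : ℕ) (x : ℝ) : (η ^ i) ^ x = (η ^ x) ^ i := by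
  rw [← ENNReal.rpow_natCast, ← ENNReal.rpow_natCast, ← ENNReal.rpow_mul, ← ENNReal.rpow_mul,
    mul_comm]

theorem exists_tsum_rpow_le (hp : 0 < p) (hq : 0 < q) (hr : r < 1) :
    ∃ C δ : ℝ≥0∞, C ≠ ∞ ∧ δ < 1 ∧ ∀ d : ℕ → ℝ≥0∞,
      ((∑' i, (r ^ i * d i) ^ p) ^ (1 / p)) ^ q ≤ C * ∑' i, δ ^ i * d i ^ q := by
  -- Half of the decay turns the `ℓ^p` sum into a supremum, which the `ℓ^q` sum bounds whatever the
  -- order of `p` and `q`; the other half stays as the weight.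
  set η : ℝ≥0∞ := r ^ (1 / 2 : ℝ)
  have hη : η < 1 := ENNReal.rpow_lt_one hr (by norm_num)
  have hηη : r = η * η := by
    rw [← ENNReal.rpow_add_of_nonneg _ _ (by norm_num) (by norm_num)]
    norm_num
  have hηp : 1 - η ^ p ≠ 0 := (tsub_pos_of_lt (ENNReal.rpow_lt_one hη hp)).ne'
  refine ⟨(((1 - η ^ p)⁻¹) ^ (1 / p)) ^ q, η ^ q, by finiteness, ENNReal.rpow_lt_one hη hq,
    fun d => ?_⟩
  set S := ∑' i, (η ^ q) ^ i * d i ^ q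
  have hterm (i : ℕ) : η ^ i * d i ≤ S ^ (1 / q) := by
    rw [one_div, ENNReal.le_rpow_inv_iff hq, ENNReal.mul_rpow_of_nonneg _ _ hq.le, pow_rpow_comm]
    exact ENNReal.le_tsum i
  have hsum : ∑' i, (r ^ i * d i) ^ p ≤ (1 - η ^ p)⁻¹ * (S ^ (1 / q)) ^ p :=
    calc ∑' i, (r ^ i * d i) ^ p ≤ ∑' i, (η ^ p) ^ i * (S ^ (1 / q)) ^ p := by
          refine ENNReal.tsum_le_tsum fun i => ?_
          rw [hηη, mul_pow, mul_assoc, ENNReal.mul_rpow_of_nonneg _ _ hp.le, pow_rpow_comm]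
          gcongr
          exact hterm i
      _ = _ := by rw [ENNReal.tsum_mul_right, ENNReal.tsum_geometric]
  calc ((∑' i, (r ^ i * d i) ^ p) ^ (1 / p)) ^ q
      ≤ (((1 - η ^ p)⁻¹ * (S ^ (1 / q)) ^ p) ^ (1 / p)) ^ q := by gcongr
    _ = _ := by
        rw [ENNReal.mul_rpow_of_nonneg _ _ (by positivity), ENNReal.mul_rpow_of_nonneg _ _ hq.le,
          ← ENNReal.rpow_mul (S ^ _), mul_one_div_cancel hp.ne', ENNReal.rpow_one,
          ← ENNReal.rpow_mul S, one_div_mul_cancel hq.ne', ENNReal.rpow_one]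

theorem exists_tsum_mul_tsum_rpow_le {ι : Type*} (σ : ℕ → Equiv.Perm ι) (hp : 0 < p) (hq : 0 < q)
    (hr : r < 1) {D : ℝ≥0∞} (hD : D ≠ ∞) {w : ι → ℝ≥0∞}
    (hw : ∀ i k, w k ≤ D * r ^ i * w (σ i k)) :
    ∃ C : ℝ≥0∞, C ≠ ∞ ∧ ∀ a : ι → ℝ≥0∞,
      ∑' k, (w k * (∑' i, a (σ i k) ^ p) ^ (1 / p)) ^ q ≤ C * ∑' k, (w k * a k) ^ q := by
  obtain ⟨C, δ, hC, hδ, h⟩ := exists_tsum_rpow_le hp hq hr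
  have hδ' : 1 - δ ≠ 0 := (tsub_pos_of_lt hδ).ne'
  refine ⟨C * ((1 - δ)⁻¹ * D ^ q), by finiteness, fun a => ?_⟩
  have hk (k : ι) : (w k * (∑' i, a (σ i k) ^ p) ^ (1 / p)) ^ q ≤
      C * ∑' i, δ ^ i * (D * (w (σ i k) * a (σ i k))) ^ q := by
    refine le_trans (ENNReal.rpow_le_rpow ?_ hq.le) (h _)
    calc w k * (∑' i, a (σ i k) ^ p) ^ (1 / p) = (∑' i, (w k * a (σ i k)) ^ p) ^ (1 / p) := by
          simp only [ENNReal.mul_rpow_of_nonneg _ _ hp.le, ENNReal.tsum_mul_left]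
          rw [ENNReal.mul_rpow_of_nonneg _ _ (by positivity), ← ENNReal.rpow_mul,
            mul_one_div_cancel hp.ne', ENNReal.rpow_one]
      _ ≤ _ := by
          gcongr ?_ ^ _
          refine ENNReal.tsum_le_tsum fun i => ENNReal.rpow_le_rpow ?_ hp.le
          calc w k * a (σ i k) ≤ D * r ^ i * w (σ i k) * a (σ i k) := by gcongr; exact hw i k
            _ = r ^ i * (D * (w (σ i k) * a (σ i k))) := by ring
  calc ∑' k, (w k * (∑' i, a (σ i k) ^ p) ^ (1 / p)) ^ q
      ≤ C * ∑' k, ∑' i, δ ^ i * (D * (w (σ i k) * a (σ i k))) ^ q := by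
        rw [← ENNReal.tsum_mul_left]
        exact ENNReal.tsum_le_tsum hk
    _ = C * ∑' i, δ ^ i * ∑' k, (D * (w k * a k)) ^ q := by
        rw [ENNReal.tsum_comm]
        simp only [ENNReal.tsum_mul_left,
          fun i => (σ i).tsum_eq fun k => (D * (w k * a k)) ^ q]
    _ = _ := by
        simp only [ENNReal.tsum_mul_right, ENNReal.tsum_geometric,
          ENNReal.mul_rpow_of_nonneg D _ hq.le, ENNReal.tsum_mul_left, mul_assoc]

end Hardy

section Partition

variable {t : ℤ → ℝ}

/-- A bi-infinite partition of `(0,∞)` into the intervals `(t k, t (k + 1)]`, some of which may be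
empty. -/
structure IsPartition (t : ℤ → ℝ) : Prop where
  pos : ∀ k, 0 < t k
  monotone : Monotone t
  cover : ∀ s, 0 < s → ∃ k, s ∈ Ioc (t k) (t (k + 1))

theorem pow_mul_le_of_two_mul_le (h : ∀ k, 2 * t k ≤ t (k + 1)) (k : ℤ) (i : ℕ) :
    2 ^ i * t k ≤ t (k + i) := by
  induction i with
  | zero => simp
  | succ i ih =>
    calc (2 : ℝ) ^ (i + 1) * t k = 2 * (2 ^ i * t k) := by ring
      _ ≤ 2 * t (k + i) := by gcongr
      _ ≤ t (k + (i + 1 : ℕ)) := by simpa [add_assoc] using h (k + i)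

theorem IsPartition.of_two_mul_le (hpos : ∀ k, 0 < t k) (h : ∀ k, 2 * t k ≤ t (k + 1)) :
    IsPartition t where
  pos := hpos
  monotone := monotone_int_of_le_succ fun k => by linarith [hpos k, h k]
  cover s hs := by
    have hmono : Monotone t := monotone_int_of_le_succ fun k => by linarith [hpos k, h k]
    obtain ⟨i, hi⟩ := pow_unbounded_of_one_lt (t 0 / s) one_lt_two
    obtain ⟨j, hj⟩ := pow_unbounded_of_one_lt (s / t 0) one_lt_two
    have hlow : t (-i) < s := by
      have hle := pow_mul_le_of_two_mul_le h (-i) i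
      rw [neg_add_cancel] at hle
      rw [div_lt_iff₀ hs] at hi
      exact lt_of_mul_lt_mul_left (hle.trans_lt hi) (by positivity)
    have hup : s < t j := by
      have hle := pow_mul_le_of_two_mul_le h 0 j
      rw [zero_add] at hle
      exact ((div_lt_iff₀ (hpos 0)).1 hj).trans_le hle
    obtain ⟨k, hk, hmax⟩ := Int.exists_greatest_of_bdd (P := fun k => t k < s)
      ⟨j, fun k hk => (hmono.reflect_lt (hk.trans hup)).le⟩ ⟨-i, hlow⟩
    refine ⟨k, hk, not_lt.1 fun hk' => ?_⟩
    exact (lt_add_one k).not_ge (hmax _ hk')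

variable {q : ℝ} {v F : ℝ → ℝ≥0∞} {C : ℝ≥0∞}

theorem setLIntegral_Ioc_mul_rpow_le (hq : 0 < q) (hF : Monotone F) {A : ℝ≥0∞} (hC : C ≠ 0)
    (hA : A ≠ 0) {s u : ℝ} (h : ∫⁻ x in Ioc s u, v x ≤ C * A ^ q) :
    ∫⁻ x in Ioc s u, v x * F x ^ q ≤ C * (A * F u) ^ q := by
  by_cases hFu : F u = ∞
  · simp [hFu, ENNReal.mul_top hA, hC, hq, ENNReal.mul_top]
  calc ∫⁻ x in Ioc s u, v x * F x ^ q ≤ ∫⁻ x in Ioc s u, v x * F u ^ q :=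
        setLIntegral_mono' measurableSet_Ioc fun x hx => by gcongr; exact hF hx.2
    _ = (∫⁻ x in Ioc s u, v x) * F u ^ q := lintegral_mul_const' _ _ (by finiteness)
    _ ≤ C * A ^ q * F u ^ q := by gcongr
    _ = C * (A * F u) ^ q := by rw [ENNReal.mul_rpow_of_nonneg _ _ hq.le, mul_assoc]

theorem mul_rpow_le_setLIntegral_Ioc (hq : 0 < q) (hF : Monotone F) {A : ℝ≥0∞} {s u : ℝ}
    (h : A ^ q ≤ C * ∫⁻ x in Ioc s u, v x) :
    (A * F s) ^ q ≤ C * ∫⁻ x in Ioc s u, v x * F x ^ q :=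
  calc (A * F s) ^ q = A ^ q * F s ^ q := ENNReal.mul_rpow_of_nonneg _ _ hq.le
    _ ≤ C * (∫⁻ x in Ioc s u, v x) * F s ^ q := by gcongr
    _ ≤ C * ∫⁻ x in Ioc s u, v x * F s ^ q := by
        rw [mul_assoc]
        gcongr
        exact lintegral_mul_const_le _ _
    _ ≤ C * ∫⁻ x in Ioc s u, v x * F x ^ q := by
        gcongr _ * ?_
        exact setLIntegral_mono' measurableSet_Ioc fun x hx => by gcongr; exact hF hx.1.le

variable {A : ℤ → ℝ≥0∞}

theorem setLIntegral_mul_rpow_le_tsum (hq : 0 < q) (hF : Monotone F) (hC : C ≠ 0)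
    (hA : ∀ k, A k ≠ 0) (h : ∀ k, ∫⁻ x in Ioc (t k) (t (k + 1)), v x ≤ C * A (k + 1) ^ q)
    {ι : Type*} [Countable ι] (κ : ι → ℤ) {S : Set ℝ}
    (hS : S ⊆ ⋃ i, Ioc (t (κ i)) (t (κ i + 1))) :
    ∫⁻ x in S, v x * F x ^ q ≤ C * ∑' i, (A (κ i + 1) * F (t (κ i + 1))) ^ q :=
  calc ∫⁻ x in S, v x * F x ^ q
      ≤ ∑' i, ∫⁻ x in Ioc (t (κ i)) (t (κ i + 1)), v x * F x ^ q :=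
        (lintegral_mono_set hS).trans (lintegral_iUnion_le _ _)
    _ ≤ ∑' i, C * (A (κ i + 1) * F (t (κ i + 1))) ^ q :=
        ENNReal.tsum_le_tsum fun _ => setLIntegral_Ioc_mul_rpow_le hq hF hC (hA _) (h _)
    _ = _ := ENNReal.tsum_mul_left

theorem IsPartition.setLIntegral_Ioi_zero_le (ht : IsPartition t) (hq : 0 < q) (hF : Monotone F)
    (hC : C ≠ 0) (hA : ∀ k, A k ≠ 0)
    (h : ∀ k, ∫⁻ x in Ioc (t k) (t (k + 1)), v x ≤ C * A (k + 1) ^ q) :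
    ∫⁻ x in Ioi 0, v x * F x ^ q ≤ C * ∑' k, (A k * F (t k)) ^ q := by
  rw [← (Equiv.addRight (1 : ℤ)).tsum_eq]
  exact setLIntegral_mul_rpow_le_tsum hq hF hC hA h id fun s hs => mem_iUnion.2 (ht.cover s hs)

theorem IsPartition.setLIntegral_Ioc_zero_le (ht : IsPartition t) (hq : 0 < q) (hF : Monotone F)
    (hC : C ≠ 0) (hA : ∀ k, A k ≠ 0)
    (h : ∀ k, ∫⁻ x in Ioc (t k) (t (k + 1)), v x ≤ C * A (k + 1) ^ q) (k : ℤ) :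
    ∫⁻ x in Ioc 0 (t k), v x * F x ^ q ≤ C * ∑' i : ℕ, (A (k - i) * F (t (k - i))) ^ q := by
  have hcover : Ioc 0 (t k) ⊆ ⋃ i : ℕ, Ioc (t (k - i - 1)) (t (k - i - 1 + 1)) := by
    intro s hs
    obtain ⟨m, hm⟩ := ht.cover s hs.1
    have hmk : m < k := ht.monotone.reflect_lt (hm.1.trans_le hs.2)
    refine mem_iUnion.2 ⟨(k - m - 1).toNat, ?_⟩
    rwa [Int.toNat_of_nonneg (by lia), show k - (k - m - 1) - 1 = m by ring]
  simpa only [sub_add_cancel] using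
    setLIntegral_mul_rpow_le_tsum hq hF hC hA h (fun i : ℕ => k - i - 1) hcover

theorem IsPartition.setLIntegral_Ioi_le (ht : IsPartition t) (hq : 0 < q) (hF : Monotone F)
    (hC : C ≠ 0) (hA : ∀ k, A k ≠ 0)
    (h : ∀ k, ∫⁻ x in Ioc (t k) (t (k + 1)), v x ≤ C * A (k + 1) ^ q) (k : ℤ) :
    ∫⁻ x in Ioi (t k), v x * F x ^ q ≤
      C * ∑' i : ℕ, (A (k + i + 1) * F (t (k + i + 1))) ^ q := by
  refine setLIntegral_mul_rpow_le_tsum hq hF hC hA h (fun i : ℕ => k + i) fun s hs => ?_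
  obtain ⟨m, hm⟩ := ht.cover s ((ht.pos k).trans hs)
  have hmk : k < m + 1 := ht.monotone.reflect_lt (lt_of_lt_of_le hs hm.2)
  refine mem_iUnion.2 ⟨(m - k).toNat, ?_⟩
  rwa [Int.toNat_of_nonneg (by lia), add_sub_cancel]

theorem IsPartition.tsum_le_setLIntegral (ht : IsPartition t) (hq : 0 < q) (hF : Monotone F)
    (h : ∀ k, A k ^ q ≤ C * ∫⁻ x in Ioc (t k) (t (k + 1)), v x) :
    ∑' k, (A k * F (t k)) ^ q ≤ C * ∫⁻ x in Ioi 0, v x * F x ^ q := by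
  have hdisj : Pairwise (Function.onFun Disjoint fun k => Ioc (t k) (t (k + 1))) :=
    ht.monotone.pairwise_disjoint_on_Ioc_succ
  calc ∑' k, (A k * F (t k)) ^ q
      ≤ ∑' k, C * ∫⁻ x in Ioc (t k) (t (k + 1)), v x * F x ^ q :=
        ENNReal.tsum_le_tsum fun k => mul_rpow_le_setLIntegral_Ioc hq hF (h k)
    _ = C * ∫⁻ x in ⋃ k, Ioc (t k) (t (k + 1)), v x * F x ^ q := by
        rw [ENNReal.tsum_mul_left, lintegral_iUnion (fun _ => measurableSet_Ioc) hdisj]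
    _ ≤ _ := by
        gcongr
        exact iUnion_subset fun k s hs => (ht.pos k).trans hs.1

end Partition

section IntermediateWeight

variable {w : ℝ → ℝ}

/-- A weight on `(0,∞)` which decays at least like a negative power and is such that `s * w s` grows
at least like a positive power. These are the properties of `s ^ (-θ) * b s`, with `0 < θ < 1` and
`b` slowly varying, that the discrete Hardy inequalities need. -/
structure IsIntermediateWeight (w : ℝ → ℝ) : Prop where
  pos : ∀ s, 0 < s → 0 < w s
  decay : ∃ M α : ℝ, 0 < M ∧ 0 < α ∧ ∀ s u, 0 < s → s ≤ u → w u ≤ M * (s / u) ^ α * w s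
  growth : ∃ M α : ℝ, 0 < M ∧ 0 < α ∧
    ∀ s u, 0 < s → s ≤ u → s * w s ≤ M * (s / u) ^ α * (u * w u)

theorem IsSlowlyVarying.isIntermediateWeight {b : ℝ → ℝ} {θ : ℝ} (hb : IsSlowlyVarying b)
    (hθ₀ : 0 < θ) (hθ₁ : θ < 1) : IsIntermediateWeight fun s => s ^ (-θ) * b s where
  pos s hs := mul_pos (Real.rpow_pos_of_pos hs _) (hb.pos s hs)
  decay := by
    obtain ⟨M, hM, h⟩ := hb.exists_le_mul_left (half_pos hθ₀)
    refine ⟨M, θ / 2, hM, half_pos hθ₀, fun s u hs hsu => ?_⟩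
    have hu : 0 < u := hs.trans_le hsu
    have hneg (x : ℝ) (hx : 0 < x) : x ^ (-θ) = (x ^ (θ / 2) * x ^ (θ / 2))⁻¹ := by
      rw [← Real.rpow_add hx, add_halves, Real.rpow_neg hx.le]
    calc u ^ (-θ) * b u ≤ u ^ (-θ) * (M * (u / s) ^ (θ / 2) * b s) := by
          gcongr
          exact h s u hs hsu
      _ = M * (s / u) ^ (θ / 2) * (s ^ (-θ) * b s) := by
          rw [hneg s hs, hneg u hu, Real.div_rpow hu.le hs.le, Real.div_rpow hs.le hu.le]
          field_simp
  growth := by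
    have hε : 0 < (1 - θ) / 2 := by linarith
    obtain ⟨M, hM, h⟩ := hb.exists_le_mul_right hε
    refine ⟨M, (1 - θ) / 2, hM, hε, fun s u hs hsu => ?_⟩
    have hu : 0 < u := hs.trans_le hsu
    have hmul (x : ℝ) (hx : 0 < x) : x * x ^ (-θ) = x ^ ((1 - θ) / 2) * x ^ ((1 - θ) / 2) := by
      rw [← Real.rpow_one_add' hx.le (by linarith), ← Real.rpow_add hx]
      ring_nf
    calc s * (s ^ (-θ) * b s) ≤ s * (s ^ (-θ) * (M * (u / s) ^ ((1 - θ) / 2) * b u)) := by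
          gcongr
          exact h s u hs hsu
      _ = M * (s / u) ^ ((1 - θ) / 2) * (u * (u ^ (-θ) * b u)) := by
          rw [← mul_assoc s, ← mul_assoc u, hmul s hs, hmul u hu, Real.div_rpow hu.le hs.le,
            Real.div_rpow hs.le hu.le]
          field_simp

theorem IsIntermediateWeight.exists_le_mul (hw : IsIntermediateWeight w) {Λ : ℝ} (hΛ : 0 < Λ) :
    ∃ C : ℝ, 0 < C ∧ ∀ x y, 0 < x → 0 < y → y ≤ Λ * x → w x ≤ C * w y := by
  obtain ⟨M, α, hM, hα, hdecay⟩ := hw.decay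
  obtain ⟨M', β, hM', hβ, hgrowth⟩ := hw.growth
  have hdiv {x y : ℝ} (hx : 0 < x) (hxy : x ≤ y) {γ : ℝ} (hγ : 0 < γ) : (x / y) ^ γ ≤ 1 :=
    Real.rpow_le_one (div_pos hx (hx.trans_le hxy)).le
      ((div_le_one (hx.trans_le hxy)).2 hxy) hγ.le
  refine ⟨M + M' * Λ, by positivity, fun x y hx hy hyx => ?_⟩
  have hwy := hw.pos y hy
  rcases le_total y x with h | h
  · calc w x ≤ M * (y / x) ^ α * w y := hdecay y x hy h
      _ ≤ M * 1 * w y := by gcongr; exact hdiv hy h hα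
      _ ≤ (M + M' * Λ) * w y := by gcongr; nlinarith [mul_pos hM' hΛ]
  · refine le_of_mul_le_mul_left ?_ hx
    calc x * w x ≤ M' * (x / y) ^ β * (y * w y) := hgrowth x y hx h
      _ ≤ M' * 1 * (Λ * x * w y) := by gcongr; exact hdiv hx h hβ
      _ = x * (M' * Λ * w y) := by ring
      _ ≤ x * ((M + M' * Λ) * w y) := by gcongr; linarith

theorem ofReal_le_ofReal_mul_pow_mul {M α s u x y : ℝ} {i : ℕ} (hM : 0 ≤ M) (hα : 0 ≤ α)
    (hs : 0 < s) (hy : 0 ≤ y) (hsu : 2 ^ i * s ≤ u) (h : x ≤ M * (s / u) ^ α * y) :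
    ENNReal.ofReal x ≤ ENNReal.ofReal M * ENNReal.ofReal ((1 / 2) ^ α) ^ i * ENNReal.ofReal y := by
  have hu : 0 < u := lt_of_lt_of_le (by positivity) hsu
  have hdiv : (s / u) ^ α ≤ ((1 / 2) ^ α) ^ i := by
    rw [Real.rpow_pow_comm (by norm_num)]
    gcongr
    rw [div_le_iff₀ hu]
    calc s = (1 / 2) ^ i * (2 ^ i * s) := by rw [← mul_assoc, ← mul_pow]; norm_num
      _ ≤ (1 / 2) ^ i * u := by gcongr
  rw [← ENNReal.ofReal_pow (by positivity), ← ENNReal.ofReal_mul hM,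
    ← ENNReal.ofReal_mul (by positivity)]
  refine ENNReal.ofReal_le_ofReal (h.trans ?_)
  gcongr

theorem ofReal_half_rpow_lt_one {α : ℝ} (hα : 0 < α) : ENNReal.ofReal ((1 / 2) ^ α) < 1 :=
  ENNReal.ofReal_lt_one.2 (Real.rpow_lt_one (by norm_num) (by norm_num) hα)

theorem IsIntermediateWeight.exists_le_pow_mul_left (hw : IsIntermediateWeight w) :
    ∃ D r : ℝ≥0∞, D ≠ ∞ ∧ r < 1 ∧ ∀ (s u : ℝ) (i : ℕ), 0 < s → 2 ^ i * s ≤ u →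
      ENNReal.ofReal (w u) ≤ D * r ^ i * ENNReal.ofReal (w s) := by
  obtain ⟨M, α, hM, hα, h⟩ := hw.decay
  refine ⟨ENNReal.ofReal M, _, ENNReal.ofReal_ne_top, ofReal_half_rpow_lt_one hα,
    fun s u i hs hsu => ofReal_le_ofReal_mul_pow_mul hM.le hα.le hs (hw.pos s hs).le hsu
      (h s u hs (le_trans ?_ hsu))⟩
  exact le_mul_of_one_le_left hs.le (one_le_pow₀ one_le_two)

theorem IsIntermediateWeight.exists_le_pow_mul_right (hw : IsIntermediateWeight w) :
    ∃ D r : ℝ≥0∞, D ≠ ∞ ∧ r < 1 ∧ ∀ (s u : ℝ) (i : ℕ), 0 < s → 2 ^ i * s ≤ u →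
      ENNReal.ofReal (s * w s) ≤ D * r ^ i * ENNReal.ofReal (u * w u) := by
  obtain ⟨M, α, hM, hα, h⟩ := hw.growth
  refine ⟨ENNReal.ofReal M, _, ENNReal.ofReal_ne_top, ofReal_half_rpow_lt_one hα,
    fun s u i hs hsu => ?_⟩
  have hle : s ≤ u := (le_mul_of_one_le_left hs.le (one_le_pow₀ one_le_two)).trans hsu
  have hu : 0 < u := hs.trans_le hle
  exact ofReal_le_ofReal_mul_pow_mul hM.le hα.le hs (mul_pos hu (hw.pos u hu)).le hsu
    (h s u hs hle)

end IntermediateWeight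

section GeometricPartition

variable {q₀ q₁ : ℝ} {b₀ b₁ : ℝ → ℝ} {Λ : ℝ} {t : ℤ → ℝ}

/-- A partition of `(0,∞)` along which the tail norm of `b₁` decays geometrically with ratio `Λ`
and `ρ` grows at least geometrically with ratio `2`. Since the tail norm of `b₀` does not increase,
`ρ` also grows at most geometrically. -/
structure IsGeometricPartition (q₀ q₁ : ℝ) (b₀ b₁ : ℝ → ℝ) (Λ : ℝ) (t : ℤ → ℝ) : Prop
    extends IsPartition t where
  one_lt : 1 < Λ
  tailNorm_eq : ∀ k, tailNorm q₁ b₁ (t k) = Λ * tailNorm q₁ b₁ (t (k + 1))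
  two_mul_rho_le : ∀ k, 2 * rho q₀ q₁ b₀ b₁ (t k) ≤ rho q₀ q₁ b₀ b₁ (t (k + 1))

theorem exists_tailNorm_eq (hq₀ : 0 < q₀) (hq₁ : 0 < q₁) (hb₀ : IsSV0 q₀ b₀) (hb₁ : IsSV0 q₁ b₁)
    (hρ_zero : Tendsto (rho q₀ q₁ b₀ b₁) (𝓝[>] 0) (𝓝 0)) {y : ℝ} (hy : 0 < y) :
    ∃ t, 0 < t ∧ tailNorm q₁ b₁ t = y := by
  have hn₀ := tailNorm_pos hq₀ hb₀ one_pos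
  obtain ⟨s, hρs, hs⟩ : ∃ s, rho q₀ q₁ b₀ b₁ s < tailNorm q₀ b₀ 1 / y ∧ s ∈ Ioo (0 : ℝ) 1 :=
    ((hρ_zero.eventually_lt_const (div_pos hn₀ hy)).and (Ioo_mem_nhdsGT one_pos)).exists
  obtain ⟨u, huy, hu⟩ : ∃ u, tailNorm q₁ b₁ u < y ∧ 0 < u :=
    (((tailNorm_tendsto_atTop hq₁).eventually_lt_const hy).and (eventually_gt_atTop 0)).exists
  have hys : y ≤ tailNorm q₁ b₁ s := by
    have hle := (tailNorm_strictAntiOn hq₀ hb₀).antitoneOn hs.1 (mem_Ioi.2 one_pos) hs.2.le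
    rw [rho, div_lt_div_iff₀ (tailNorm_pos hq₁ hb₁ hs.1) hy] at hρs
    refine (lt_of_mul_lt_mul_left (lt_of_le_of_lt ?_ hρs) hn₀.le).le
    gcongr
  exact isPreconnected_Ioi.intermediate_value hu hs.1 (continuousOn_tailNorm hq₁ hb₁)
    ⟨huy.le, hys⟩

theorem two_mul_rho_le_of_tailNorm_eq (hq₀ : 0 < q₀) (hq₁ : 0 < q₁) (hb₀ : IsSV0 q₀ b₀)
    (hb₁ : IsSV0 q₁ b₁) {α M s u : ℝ} (hΛ : 0 < Λ) (hM : 2 * M ≤ Λ ^ α) (hs : 0 < s)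
    (hu : 0 < u) (heq : tailNorm q₁ b₁ s = Λ * tailNorm q₁ b₁ u)
    (h : rho q₀ q₁ b₀ b₁ s * tailNorm q₁ b₁ s ^ α ≤
      M * (rho q₀ q₁ b₀ b₁ u * tailNorm q₁ b₁ u ^ α)) :
    2 * rho q₀ q₁ b₀ b₁ s ≤ rho q₀ q₁ b₀ b₁ u := by
  have hρs := rho_pos hq₀ hq₁ hb₀ hb₁ hs
  have hρu := rho_pos hq₀ hq₁ hb₀ hb₁ hu
  have hn := tailNorm_pos hq₁ hb₁ hu
  have hnα : 0 < Λ ^ α * tailNorm q₁ b₁ u ^ α := by positivity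
  refine le_of_mul_le_mul_right ?_ hnα
  rw [heq, Real.mul_rpow hΛ.le hn.le] at h
  calc 2 * rho q₀ q₁ b₀ b₁ s * (Λ ^ α * tailNorm q₁ b₁ u ^ α)
      ≤ 2 * M * (rho q₀ q₁ b₀ b₁ u * tailNorm q₁ b₁ u ^ α) := by linarith
    _ ≤ Λ ^ α * (rho q₀ q₁ b₀ b₁ u * tailNorm q₁ b₁ u ^ α) := by gcongr
    _ = _ := by ring

theorem exists_isGeometricPartition (hq₀ : 0 < q₀) (hq₁ : 0 < q₁) (hb₀ : IsSV0 q₀ b₀)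
    (hb₁ : IsSV0 q₁ b₁) (hρ_zero : Tendsto (rho q₀ q₁ b₀ b₁) (𝓝[>] 0) (𝓝 0)) {α : ℝ}
    (hα : 0 < α)
    (hρ_growth : EquivNondecreasing fun t => rho q₀ q₁ b₀ b₁ t * tailNorm q₁ b₁ t ^ α) :
    ∃ (Λ : ℝ) (t : ℤ → ℝ), IsGeometricPartition q₀ q₁ b₀ b₁ Λ t := by
  obtain ⟨M, -, hM⟩ := hρ_growth.exists_le_mul
  obtain ⟨Λ, hΛM, hΛ⟩ : ∃ Λ : ℝ, 2 * M ≤ Λ ^ α ∧ 1 < Λ :=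
    (((tendsto_rpow_atTop hα).eventually_ge_atTop _).and (eventually_gt_atTop 1)).exists
  have hΛ₀ : 0 < Λ := one_pos.trans hΛ
  choose t htpos ht using fun k : ℤ =>
    exists_tailNorm_eq hq₀ hq₁ hb₀ hb₁ hρ_zero (zpow_pos hΛ₀ (-k))
  have hanti := tailNorm_strictAntiOn hq₁ hb₁
  have hmono : Monotone t := fun k l hkl => by
    rw [← hanti.le_iff_ge (htpos l) (htpos k), ht, ht]
    exact zpow_le_zpow_right₀ hΛ.le (neg_le_neg hkl)
  have hsucc (k : ℤ) : tailNorm q₁ b₁ (t k) = Λ * tailNorm q₁ b₁ (t (k + 1)) := by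
    rw [ht, ht, ← zpow_one_add₀ hΛ₀.ne']
    congr 1
    ring
  refine ⟨Λ, t, ⟨⟨htpos, hmono, fun s hs => ?_⟩, hΛ, hsucc, fun k =>
    two_mul_rho_le_of_tailNorm_eq hq₀ hq₁ hb₀ hb₁ hΛ₀ hΛM (htpos k) (htpos _) (hsucc k)
      (hM _ _ (htpos k) (hmono (lt_add_one k).le))⟩⟩
  have hns := tailNorm_pos hq₁ hb₁ hs
  obtain ⟨k, hk⟩ := exists_mem_Ioc_zpow (inv_pos.2 hns) hΛ
  refine ⟨k, (hanti.lt_iff_gt hs (htpos k)).1 ?_, (hanti.le_iff_ge (htpos _) hs).1 ?_⟩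
  · rw [ht, zpow_neg]
    exact (lt_inv_comm₀ (zpow_pos hΛ₀ k) hns).1 hk.1
  · rw [ht, zpow_neg]
    exact (inv_le_comm₀ hns (zpow_pos hΛ₀ _)).1 hk.2

theorem tailNorm_le_mul_of_mem_Icc {q : ℝ} {b : ℝ → ℝ} (hq : 0 < q) (hb : IsSV0 q b)
    {c x y s u : ℝ} (hc : 0 ≤ c) (hx : 0 < x) (h : tailNorm q b x ≤ c * tailNorm q b y)
    (hs : s ∈ Icc x y) (hu : u ∈ Icc x y) : tailNorm q b s ≤ c * tailNorm q b u := by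
  have hanti := (tailNorm_strictAntiOn hq hb).antitoneOn
  have hu₀ : 0 < u := hx.trans_le hu.1
  calc tailNorm q b s ≤ tailNorm q b x := hanti hx (hx.trans_le hs.1) hs.1
    _ ≤ c * tailNorm q b y := h
    _ ≤ c * tailNorm q b u := by gcongr; exact hanti hu₀ (hu₀.trans_le hu.2) hu.2

namespace IsGeometricPartition

variable (ht : IsGeometricPartition q₀ q₁ b₀ b₁ Λ t)
include ht

theorem tailNorm_right_le (hq₁ : 0 < q₁) (hb₁ : IsSV0 q₁ b₁) {k : ℤ} {s u : ℝ}
    (hs : s ∈ Icc (t k) (t (k + 1))) (hu : u ∈ Icc (t k) (t (k + 1))) :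
    tailNorm q₁ b₁ s ≤ Λ * tailNorm q₁ b₁ u :=
  tailNorm_le_mul_of_mem_Icc hq₁ hb₁ (one_pos.trans ht.one_lt).le (ht.pos k)
    (ht.tailNorm_eq k).le hs hu

theorem tailNorm_left_le (hq₀ : 0 < q₀) (hq₁ : 0 < q₁) (hb₀ : IsSV0 q₀ b₀) (hb₁ : IsSV0 q₁ b₁)
    {k : ℤ} {s u : ℝ} (hs : s ∈ Icc (t k) (t (k + 1))) (hu : u ∈ Icc (t k) (t (k + 1))) :
    tailNorm q₀ b₀ s ≤ Λ * tailNorm q₀ b₀ u := by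
  have hΛ := one_pos.trans ht.one_lt
  have hn := tailNorm_pos hq₁ hb₁ (ht.pos (k + 1))
  have hρ : rho q₀ q₁ b₀ b₁ (t k) ≤ rho q₀ q₁ b₀ b₁ (t (k + 1)) := by
    linarith [ht.two_mul_rho_le k, rho_pos hq₀ hq₁ hb₀ hb₁ (ht.pos k)]
  refine tailNorm_le_mul_of_mem_Icc hq₀ hb₀ hΛ.le (ht.pos k) ?_ hs hu
  calc tailNorm q₀ b₀ (t k) = rho q₀ q₁ b₀ b₁ (t k) * (Λ * tailNorm q₁ b₁ (t (k + 1))) := by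
        rw [← ht.tailNorm_eq, rho_mul_tailNorm hq₁ hb₁ (ht.pos k)]
    _ ≤ rho q₀ q₁ b₀ b₁ (t (k + 1)) * (Λ * tailNorm q₁ b₁ (t (k + 1))) := by gcongr
    _ = Λ * tailNorm q₀ b₀ (t (k + 1)) := by
        rw [mul_left_comm, rho_mul_tailNorm hq₁ hb₁ (ht.pos _)]

theorem rho_le (hq₀ : 0 < q₀) (hq₁ : 0 < q₁) (hb₀ : IsSV0 q₀ b₀) (hb₁ : IsSV0 q₁ b₁)
    {k : ℤ} {s u : ℝ} (hs : s ∈ Icc (t k) (t (k + 1))) (hu : u ∈ Icc (t k) (t (k + 1))) :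
    rho q₀ q₁ b₀ b₁ s ≤ Λ ^ 2 * rho q₀ q₁ b₀ b₁ u := by
  have hΛ := one_pos.trans ht.one_lt
  have hns := tailNorm_pos hq₁ hb₁ ((ht.pos k).trans_le hs.1)
  have hnu := tailNorm_pos hq₁ hb₁ ((ht.pos k).trans_le hu.1)
  have hmu := tailNorm_pos hq₀ hb₀ ((ht.pos k).trans_le hu.1)
  rw [rho, rho, ← mul_div_assoc, div_le_div_iff₀ hns hnu]
  calc tailNorm q₀ b₀ s * tailNorm q₁ b₁ u
      ≤ Λ * tailNorm q₀ b₀ u * (Λ * tailNorm q₁ b₁ s) := by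
        gcongr
        · exact ht.tailNorm_left_le hq₀ hq₁ hb₀ hb₁ hs hu
        · exact ht.tailNorm_right_le hq₁ hb₁ hu hs
    _ = Λ ^ 2 * tailNorm q₀ b₀ u * tailNorm q₁ b₁ s := by ring

theorem isPartition_rho (hq₀ : 0 < q₀) (hq₁ : 0 < q₁) (hb₀ : IsSV0 q₀ b₀) (hb₁ : IsSV0 q₁ b₁) :
    IsPartition fun k => rho q₀ q₁ b₀ b₁ (t k) :=
  IsPartition.of_two_mul_le (fun k => rho_pos hq₀ hq₁ hb₀ hb₁ (ht.pos k)) ht.two_mul_rho_le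

end IsGeometricPartition

end GeometricPartition

section Discretization

variable {q : ℝ}

theorem density_mul (hq : 0 ≤ q) {a b : ℝ → ℝ} {s : ℝ} (ha : 0 ≤ a s) (hb : 0 ≤ b s) :
    density q (fun s => a s * b s) s = ENNReal.ofReal (a s) ^ q * density q b s := by
  rw [density_eq (b := fun s => a s * b s) hq (mul_nonneg ha hb), density_eq hq hb,
    ENNReal.ofReal_mul ha, ENNReal.mul_rpow_of_nonneg _ _ hq, mul_assoc]

section Comparison

variable {a : ℝ → ℝ} {g : ℝ → ℝ≥0∞} {S : Set ℝ} {c : ℝ}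

theorem setLIntegral_ofReal_rpow_mul_le (hq : 0 ≤ q) (hS : MeasurableSet S)
    (h : ∀ s ∈ S, a s ≤ c) :
    ∫⁻ s in S, ENNReal.ofReal (a s) ^ q * g s ≤ ENNReal.ofReal c ^ q * ∫⁻ s in S, g s := by
  rw [← lintegral_const_mul' _ _ (by finiteness)]
  exact setLIntegral_mono' hS fun s hs => by gcongr; exact h s hs

theorem ofReal_rpow_mul_setLIntegral_le (hq : 0 ≤ q) (hS : MeasurableSet S) {A : ℝ} (hc : 0 ≤ c)
    (h : ∀ s ∈ S, A ≤ c * a s) :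
    ENNReal.ofReal A ^ q * ∫⁻ s in S, g s ≤
      ENNReal.ofReal c ^ q * ∫⁻ s in S, ENNReal.ofReal (a s) ^ q * g s := by
  rw [← lintegral_const_mul' _ _ (by finiteness), ← lintegral_const_mul' _ _ (by finiteness)]
  refine setLIntegral_mono' hS fun s hs => ?_
  rw [← mul_assoc, ← ENNReal.mul_rpow_of_nonneg _ _ hq, ← ENNReal.ofReal_mul hc]
  gcongr
  exact h s hs

variable {t : ℤ → ℝ} {F : ℝ → ℝ≥0∞} {G : ℝ≥0∞}

theorem IsPartition.setLIntegral_rpow_mul_le_tsum (ht : IsPartition t) (hq : 0 < q) (hc : 0 < c)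
    (ha : ∀ s, 0 < s → 0 < a s)
    (hac : ∀ k, ∀ s ∈ Icc (t k) (t (k + 1)), ∀ u ∈ Icc (t k) (t (k + 1)), a s ≤ c * a u)
    (hG : G ≠ 0) (hg : ∀ k, ∫⁻ s in Ioc (t k) (t (k + 1)), g s ≤ G) (hF : Monotone F) :
    ∫⁻ s in Ioi 0, ENNReal.ofReal (a s) ^ q * g s * F s ^ q ≤
      ENNReal.ofReal c ^ q * G * ∑' k, (ENNReal.ofReal (a (t k)) * F (t k)) ^ q := by
  refine ht.setLIntegral_Ioi_zero_le hq hF ?_ (A := fun k => ENNReal.ofReal (a (t k)))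
    (fun k => (ENNReal.ofReal_pos.2 (ha _ (ht.pos k))).ne') fun k => ?_
  · exact mul_ne_zero (ENNReal.rpow_pos (ENNReal.ofReal_pos.2 hc) ENNReal.ofReal_ne_top).ne' hG
  calc ∫⁻ s in Ioc (t k) (t (k + 1)), ENNReal.ofReal (a s) ^ q * g s
      ≤ ENNReal.ofReal (c * a (t (k + 1))) ^ q * ∫⁻ s in Ioc (t k) (t (k + 1)), g s :=
        setLIntegral_ofReal_rpow_mul_le hq.le measurableSet_Ioc fun s hs =>
          hac k s (Ioc_subset_Icc_self hs) _ (right_mem_Icc.2 (ht.monotone (lt_add_one k).le))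
    _ ≤ ENNReal.ofReal (c * a (t (k + 1))) ^ q * G := by gcongr; exact hg k
    _ = ENNReal.ofReal c ^ q * G * ENNReal.ofReal (a (t (k + 1))) ^ q := by
        rw [ENNReal.ofReal_mul hc.le, ENNReal.mul_rpow_of_nonneg _ _ hq.le]
        ring

theorem IsPartition.tsum_le_setLIntegral_rpow_mul (ht : IsPartition t) (hq : 0 < q) (hc : 0 ≤ c)
    (hac : ∀ k, ∀ s ∈ Icc (t k) (t (k + 1)), ∀ u ∈ Icc (t k) (t (k + 1)), a s ≤ c * a u)
    (hg : ∀ k, 1 ≤ G * ∫⁻ s in Ioc (t k) (t (k + 1)), g s) (hF : Monotone F) :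
    ∑' k, (ENNReal.ofReal (a (t k)) * F (t k)) ^ q ≤
      ENNReal.ofReal c ^ q * G * ∫⁻ s in Ioi 0, ENNReal.ofReal (a s) ^ q * g s * F s ^ q := by
  refine ht.tsum_le_setLIntegral hq hF fun k => ?_
  have hle (s : ℝ) (hs : s ∈ Ioc (t k) (t (k + 1))) : a (t k) ≤ c * a s :=
    hac k _ (left_mem_Icc.2 (ht.monotone (lt_add_one k).le)) s (Ioc_subset_Icc_self hs)
  calc ENNReal.ofReal (a (t k)) ^ q
      ≤ ENNReal.ofReal (a (t k)) ^ q * (G * ∫⁻ s in Ioc (t k) (t (k + 1)), g s) :=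
        le_mul_of_one_le_right' (hg k)
    _ = G * (ENNReal.ofReal (a (t k)) ^ q * ∫⁻ s in Ioc (t k) (t (k + 1)), g s) :=
        mul_left_comm _ _ _
    _ ≤ G * (ENNReal.ofReal c ^ q *
          ∫⁻ s in Ioc (t k) (t (k + 1)), ENNReal.ofReal (a s) ^ q * g s) := by
        gcongr _ * ?_
        exact ofReal_rpow_mul_setLIntegral_le hq.le measurableSet_Ioc hc hle
    _ = _ := by ring

end Comparison

section LogarithmicLength

theorem lintegral_density_one_le {x y : ℝ} (hx : 0 < x) :
    ∫⁻ s in Ioc x y, density q (fun _ => 1) s ≤ ENNReal.ofReal (y / x) := by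
  simp only [density, Real.one_rpow]
  calc ∫⁻ s in Ioc x y, ENNReal.ofReal (1 / s) ≤ ∫⁻ _ in Ioc x y, ENNReal.ofReal (1 / x) :=
        setLIntegral_mono' measurableSet_Ioc fun s hs => by gcongr; exact hs.1.le
    _ = ENNReal.ofReal (1 / x * (y - x)) := by
        rw [setLIntegral_const, Real.volume_Ioc, ENNReal.ofReal_mul (by positivity)]
    _ ≤ ENNReal.ofReal (y / x) := by
        gcongr
        rw [one_div_mul_eq_div]
        gcongr
        linarith

theorem one_le_two_mul_lintegral_density_one {x y : ℝ} (hx : 0 < x) (hxy : 2 * x ≤ y) :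
    1 ≤ 2 * ∫⁻ s in Ioc x y, density q (fun _ => 1) s := by
  have hy : 0 < y := by linarith
  simp only [density, Real.one_rpow]
  calc (1 : ℝ≥0∞) ≤ ENNReal.ofReal (2 * (1 / y * (y - x))) := by
        rw [ENNReal.one_le_ofReal, one_div_mul_eq_div, ← mul_div_assoc, one_le_div hy]
        linarith
    _ = 2 * ∫⁻ _ in Ioc x y, ENNReal.ofReal (1 / y) := by
        rw [setLIntegral_const, Real.volume_Ioc, ENNReal.ofReal_mul (by norm_num),
          ENNReal.ofReal_mul (by positivity), ENNReal.ofReal_ofNat]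
    _ ≤ 2 * ∫⁻ s in Ioc x y, ENNReal.ofReal (1 / s) := by
        gcongr 2 * ?_
        refine setLIntegral_mono' measurableSet_Ioc fun s hs => ?_
        have hs₀ := hx.trans hs.1
        gcongr
        exact hs.2

variable {b : ℝ → ℝ} {c x y : ℝ}

theorem lintegral_density_div_tailNorm (hq : 0 < q) (hb : IsSV0 q b) (hx : 0 < x) :
    ∫⁻ s in Ioc x y, density q (fun s => (tailNorm q b s)⁻¹ * b s) s =
      ∫⁻ s in Ioc x y, ENNReal.ofReal (tailNorm q b s)⁻¹ ^ q * density q b s :=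
  setLIntegral_congr_fun measurableSet_Ioc fun _ hs =>
    density_mul hq.le (inv_nonneg.2 (tailNorm_pos hq hb (hx.trans hs.1)).le)
      (hb.pos (hx.trans hs.1)).le

theorem lintegral_density_div_tailNorm_le (hq : 0 < q) (hb : IsSV0 q b) (hx : 0 < x) (hy : 0 < y)
    (h : tailNorm q b x ≤ c * tailNorm q b y) :
    ∫⁻ s in Ioc x y, density q (fun s => (tailNorm q b s)⁻¹ * b s) s ≤ ENNReal.ofReal c ^ q := by
  have hn := tailNorm_pos hq hb hy
  have hle (s : ℝ) (hs : s ∈ Ioc x y) : (tailNorm q b s)⁻¹ ≤ (tailNorm q b y)⁻¹ := by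
    gcongr
    exact (tailNorm_strictAntiOn hq hb).antitoneOn (hx.trans hs.1) hy hs.2
  calc ∫⁻ s in Ioc x y, density q (fun s => (tailNorm q b s)⁻¹ * b s) s
      ≤ ENNReal.ofReal (tailNorm q b y)⁻¹ ^ q * ∫⁻ s in Ioc x y, density q b s := by
        rw [lintegral_density_div_tailNorm hq hb hx]
        exact setLIntegral_ofReal_rpow_mul_le hq.le measurableSet_Ioc hle
    _ ≤ ENNReal.ofReal (tailNorm q b y)⁻¹ ^ q * ENNReal.ofReal (tailNorm q b x) ^ q := by
        rw [ofReal_tailNorm_rpow hq hb hx, ← lintegral_density_Ioi hq hb hx]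
        gcongr
        exact Ioc_subset_Ioi_self
    _ ≤ ENNReal.ofReal c ^ q := by
        rw [← ENNReal.mul_rpow_of_nonneg _ _ hq.le, ← ENNReal.ofReal_mul (by positivity)]
        gcongr
        rwa [inv_mul_le_iff₀ hn, mul_comm]

theorem one_le_mul_lintegral_density_div_tailNorm (hq : 0 < q) (hb : IsSV0 q b) (hx : 0 < x)
    (hxy : x ≤ y) (hc : 1 < c) (h : tailNorm q b x = c * tailNorm q b y) :
    1 ≤ ENNReal.ofReal (1 - (c ^ q)⁻¹)⁻¹ *
      ∫⁻ s in Ioc x y, density q (fun s => (tailNorm q b s)⁻¹ * b s) s := by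
  have hn := tailNorm_pos hq hb hx
  have hn' := tailNorm_pos hq hb (hx.trans_le hxy)
  have hcq : 0 < 1 - (c ^ q)⁻¹ := sub_pos.2 (inv_lt_one_of_one_lt₀ (Real.one_lt_rpow hc hq))
  have hle (s : ℝ) (hs : s ∈ Ioc x y) : (tailNorm q b x)⁻¹ ≤ 1 * (tailNorm q b s)⁻¹ := by
    have hns := tailNorm_pos hq hb (hx.trans hs.1)
    rw [one_mul]
    gcongr
    exact (tailNorm_strictAntiOn hq hb).antitoneOn hx (hx.trans hs.1) hs.1.le
  have htail : (tailNorm q b x)⁻¹ ^ q * (tail q b x - tail q b y) = 1 - (c ^ q)⁻¹ := by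
    rw [← tailNorm_rpow hq hb hx, ← tailNorm_rpow hq hb (hx.trans_le hxy), h,
      Real.inv_rpow (by positivity), Real.mul_rpow (by positivity) hn'.le]
    field_simp
  calc (1 : ℝ≥0∞) = ENNReal.ofReal (1 - (c ^ q)⁻¹)⁻¹ *
          (ENNReal.ofReal (tailNorm q b x)⁻¹ ^ q * ∫⁻ s in Ioc x y, density q b s) := by
        rw [lintegral_density_Ioc hq hb hx hxy, ENNReal.ofReal_rpow_of_pos (inv_pos.2 hn),
          ← ENNReal.ofReal_mul (by positivity), htail, ← ENNReal.ofReal_mul (by positivity),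
          inv_mul_cancel₀ hcq.ne', ENNReal.ofReal_one]
    _ ≤ _ := by
        gcongr _ * ?_
        rw [lintegral_density_div_tailNorm hq hb hx]
        simpa only [ENNReal.ofReal_one, ENNReal.one_rpow, one_mul] using
          ofReal_rpow_mul_setLIntegral_le hq.le measurableSet_Ioc zero_le_one hle

end LogarithmicLength

end Discretization

section Spaces

variable {θ q q₀ q₁ : ℝ} {b b₀ b₁ : ℝ → ℝ} {Λ : ℝ} {t : ℤ → ℝ}

theorem btilde_pos (hq₀ : 0 < q₀) (hq₁ : 0 < q₁) (hb₀ : IsSV0 q₀ b₀) (hb₁ : IsSV0 q₁ b₁)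
    (hb : ∀ s, 0 < s → 0 < b s) {s : ℝ} (hs : 0 < s) : 0 < btilde θ q q₀ q₁ b b₀ b₁ s := by
  have hρ := rho_pos hq₀ hq₁ hb₀ hb₁ hs
  have hbρ := hb _ hρ
  have hb₁s := hb₁.pos hs
  have hT := tail_pos hq₁ hb₁ hs
  rw [btilde]
  positivity

theorem btilde_eq (hq₀ : 0 < q₀) (hq₁ : 0 < q₁) (hb₀ : IsSV0 q₀ b₀) (hb₁ : IsSV0 q₁ b₁)
    {s : ℝ} (hs : 0 < s) :
    btilde θ q q₀ q₁ b b₀ b₁ s = rho q₀ q₁ b₀ b₁ s ^ (-θ) * b (rho q₀ q₁ b₀ b₁ s) *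
      tailNorm q₀ b₀ s * ((tailNorm q₁ b₁ s)⁻¹ * b₁ s) ^ (q₁ / q) := by
  have hρ := rho_pos hq₀ hq₁ hb₀ hb₁ hs
  have hn := tailNorm_pos hq₁ hb₁ hs
  have hT : tail q₁ b₁ s ^ (1 / q₁ - 1 / q) =
      tailNorm q₁ b₁ s * (tailNorm q₁ b₁ s)⁻¹ ^ (q₁ / q) := by
    rw [← tailNorm_rpow hq₁ hb₁ hs, ← Real.rpow_mul hn.le, mul_sub, mul_one_div_cancel hq₁.ne',
      mul_one_div, Real.rpow_sub hn, Real.rpow_one, Real.inv_rpow hn.le, div_eq_mul_inv]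
  rw [btilde, hT, Real.mul_rpow (inv_nonneg.2 hn.le) (hb₁.pos hs).le,
    ← rho_mul_tailNorm (q₀ := q₀) (b₀ := b₀) hq₁ hb₁ hs, sub_eq_neg_add, Real.rpow_add_one hρ.ne']
  ring

theorem density_btilde (hq : 0 < q) (hq₀ : 0 < q₀) (hq₁ : 0 < q₁) (hb₀ : IsSV0 q₀ b₀)
    (hb₁ : IsSV0 q₁ b₁) (hb : ∀ s, 0 < s → 0 < b s) {s : ℝ} (hs : 0 < s) :
    density q (btilde θ q q₀ q₁ b b₀ b₁) s =
      ENNReal.ofReal (rho q₀ q₁ b₀ b₁ s ^ (-θ) * b (rho q₀ q₁ b₀ b₁ s) * tailNorm q₀ b₀ s) ^ q *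
        density q₁ (fun s => (tailNorm q₁ b₁ s)⁻¹ * b₁ s) s := by
  have hx : 0 ≤ (tailNorm q₁ b₁ s)⁻¹ * b₁ s :=
    mul_nonneg (inv_nonneg.2 (tailNorm_pos hq₁ hb₁ hs).le) (hb₁.pos hs).le
  have ha : 0 ≤ rho q₀ q₁ b₀ b₁ s ^ (-θ) * b (rho q₀ q₁ b₀ b₁ s) * tailNorm q₀ b₀ s := by
    have hρ := rho_pos hq₀ hq₁ hb₀ hb₁ hs
    have hbρ := hb _ hρ
    have hn := tailNorm_pos hq₀ hb₀ hs
    positivity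
  rw [density, density, btilde_eq hq₀ hq₁ hb₀ hb₁ hs, Real.mul_rpow ha (by positivity),
    ← Real.rpow_mul hx, div_mul_cancel₀ _ hq.ne', mul_div_assoc,
    ENNReal.ofReal_mul (by positivity), ENNReal.ofReal_rpow_of_nonneg ha hq.le]

end Spaces

section Sampling

variable {w : ℝ → ℝ} {q q₀ q₁ : ℝ} {b₀ b₁ : ℝ → ℝ} {Λ : ℝ} {t : ℤ → ℝ}

theorem density_eq_ofReal_rpow_mul (hq : 0 ≤ q) {s : ℝ} (hs : 0 ≤ w s) :
    density q w s = ENNReal.ofReal (w s) ^ q * density q (fun _ => 1) s := by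
  simpa only [mul_one] using density_mul (b := fun _ => 1) hq hs zero_le_one

namespace IsGeometricPartition

variable (ht : IsGeometricPartition q₀ q₁ b₀ b₁ Λ t)
include ht

theorem exists_rho_mul_tailNorm_le (hq₀ : 0 < q₀) (hq₁ : 0 < q₁) (hb₀ : IsSV0 q₀ b₀)
    (hb₁ : IsSV0 q₁ b₁) (hw : IsIntermediateWeight w) :
    ∃ c : ℝ, 0 < c ∧ ∀ k, ∀ s ∈ Icc (t k) (t (k + 1)), ∀ u ∈ Icc (t k) (t (k + 1)),
      w (rho q₀ q₁ b₀ b₁ s) * tailNorm q₀ b₀ s ≤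
        c * (w (rho q₀ q₁ b₀ b₁ u) * tailNorm q₀ b₀ u) := by
  have hΛ : 0 < Λ := one_pos.trans ht.one_lt
  obtain ⟨C, hC, h⟩ := hw.exists_le_mul (pow_pos hΛ 2)
  refine ⟨C * Λ, mul_pos hC hΛ, fun k s hs u hu => ?_⟩
  have hs₀ : 0 < s := (ht.pos k).trans_le hs.1
  have hu₀ : 0 < u := (ht.pos k).trans_le hu.1
  have hρs := rho_pos hq₀ hq₁ hb₀ hb₁ hs₀
  have hρu := rho_pos hq₀ hq₁ hb₀ hb₁ hu₀
  calc w (rho q₀ q₁ b₀ b₁ s) * tailNorm q₀ b₀ s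
      ≤ C * w (rho q₀ q₁ b₀ b₁ u) * (Λ * tailNorm q₀ b₀ u) :=
        mul_le_mul (h _ _ hρs hρu (ht.rho_le hq₀ hq₁ hb₀ hb₁ hu hs))
          (ht.tailNorm_left_le hq₀ hq₁ hb₀ hb₁ hs hu) (tailNorm_pos hq₀ hb₀ hs₀).le
          (mul_pos hC (hw.pos _ hρu)).le
    _ = C * Λ * (w (rho q₀ q₁ b₀ b₁ u) * tailNorm q₀ b₀ u) := by ring

theorem exists_weight_rho_le (hq₀ : 0 < q₀) (hq₁ : 0 < q₁) (hb₀ : IsSV0 q₀ b₀)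
    (hb₁ : IsSV0 q₁ b₁) (hw : IsIntermediateWeight w) :
    ∃ c : ℝ, 0 < c ∧ ∀ k, ∀ x ∈ Icc (rho q₀ q₁ b₀ b₁ (t k)) (rho q₀ q₁ b₀ b₁ (t (k + 1))),
      ∀ y ∈ Icc (rho q₀ q₁ b₀ b₁ (t k)) (rho q₀ q₁ b₀ b₁ (t (k + 1))), w x ≤ c * w y := by
  have hΛ : 0 < Λ := one_pos.trans ht.one_lt
  obtain ⟨C, hC, h⟩ := hw.exists_le_mul (pow_pos hΛ 2)
  refine ⟨C, hC, fun k x hx y hy => ?_⟩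
  have hk := rho_pos hq₀ hq₁ hb₀ hb₁ (ht.pos k)
  have hle : t k ≤ t (k + 1) := ht.monotone (lt_add_one k).le
  refine h x y (hk.trans_le hx.1) (hk.trans_le hy.1) ?_
  calc y ≤ rho q₀ q₁ b₀ b₁ (t (k + 1)) := hy.2
    _ ≤ Λ ^ 2 * rho q₀ q₁ b₀ b₁ (t k) :=
        ht.rho_le hq₀ hq₁ hb₀ hb₁ (right_mem_Icc.2 hle) (left_mem_Icc.2 hle)
    _ ≤ Λ ^ 2 * x := by gcongr; exact hx.1

theorem exists_setLIntegral_tailNorm_le_tsum (hq₀ : 0 < q₀) (hq₁ : 0 < q₁) (hb₀ : IsSV0 q₀ b₀)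
    (hb₁ : IsSV0 q₁ b₁) (hq : 0 < q) (hw : IsIntermediateWeight w) :
    ∃ C : ℝ≥0∞, C ≠ ∞ ∧ ∀ F : ℝ → ℝ≥0∞, Monotone F →
      ∫⁻ s in Ioi 0, ENNReal.ofReal (w (rho q₀ q₁ b₀ b₁ s) * tailNorm q₀ b₀ s) ^ q *
          density q₁ (fun s => (tailNorm q₁ b₁ s)⁻¹ * b₁ s) s * F s ^ q ≤
        C * ∑' k, (ENNReal.ofReal (w (rho q₀ q₁ b₀ b₁ (t k)) * tailNorm q₀ b₀ (t k)) *
          F (t k)) ^ q := by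
  obtain ⟨c, hc, hac⟩ := ht.exists_rho_mul_tailNorm_le hq₀ hq₁ hb₀ hb₁ hw
  have hΛ : 0 < ENNReal.ofReal Λ := ENNReal.ofReal_pos.2 (one_pos.trans ht.one_lt)
  exact ⟨ENNReal.ofReal c ^ q * ENNReal.ofReal Λ ^ q₁, by finiteness, fun F hF =>
    ht.setLIntegral_rpow_mul_le_tsum hq hc
      (fun s hs => mul_pos (hw.pos _ (rho_pos hq₀ hq₁ hb₀ hb₁ hs)) (tailNorm_pos hq₀ hb₀ hs)) hac
      (ENNReal.rpow_pos hΛ ENNReal.ofReal_ne_top).ne'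
      (fun k => lintegral_density_div_tailNorm_le hq₁ hb₁ (ht.pos k) (ht.pos _)
        (ht.tailNorm_eq k).le) hF⟩

theorem exists_tsum_le_setLIntegral_tailNorm (hq₀ : 0 < q₀) (hq₁ : 0 < q₁) (hb₀ : IsSV0 q₀ b₀)
    (hb₁ : IsSV0 q₁ b₁) (hq : 0 < q) (hw : IsIntermediateWeight w) :
    ∃ C : ℝ≥0∞, C ≠ ∞ ∧ ∀ F : ℝ → ℝ≥0∞, Monotone F →
      ∑' k, (ENNReal.ofReal (w (rho q₀ q₁ b₀ b₁ (t k)) * tailNorm q₀ b₀ (t k)) * F (t k)) ^ q ≤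
        C * ∫⁻ s in Ioi 0, ENNReal.ofReal (w (rho q₀ q₁ b₀ b₁ s) * tailNorm q₀ b₀ s) ^ q *
          density q₁ (fun s => (tailNorm q₁ b₁ s)⁻¹ * b₁ s) s * F s ^ q := by
  obtain ⟨c, hc, hac⟩ := ht.exists_rho_mul_tailNorm_le hq₀ hq₁ hb₀ hb₁ hw
  exact ⟨ENNReal.ofReal c ^ q * ENNReal.ofReal (1 - (Λ ^ q₁)⁻¹)⁻¹, by finiteness, fun F hF =>
    ht.tsum_le_setLIntegral_rpow_mul hq hc.le hac
      (fun k => one_le_mul_lintegral_density_div_tailNorm hq₁ hb₁ (ht.pos k)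
        (ht.monotone (lt_add_one k).le) ht.one_lt (ht.tailNorm_eq k)) hF⟩

theorem exists_setLIntegral_density_le_tsum (hq₀ : 0 < q₀) (hq₁ : 0 < q₁) (hb₀ : IsSV0 q₀ b₀)
    (hb₁ : IsSV0 q₁ b₁) (hq : 0 < q) (hw : IsIntermediateWeight w) :
    ∃ C : ℝ≥0∞, C ≠ ∞ ∧ ∀ F : ℝ → ℝ≥0∞, Monotone F →
      ∫⁻ s in Ioi 0, density q w s * F s ^ q ≤
        C * ∑' k, (ENNReal.ofReal (w (rho q₀ q₁ b₀ b₁ (t k))) * F (rho q₀ q₁ b₀ b₁ (t k))) ^ q := by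
  obtain ⟨c, hc, hac⟩ := ht.exists_weight_rho_le hq₀ hq₁ hb₀ hb₁ hw
  have hP := ht.isPartition_rho hq₀ hq₁ hb₀ hb₁
  have hΛ : 0 < Λ := one_pos.trans ht.one_lt
  refine ⟨ENNReal.ofReal c ^ q * ENNReal.ofReal (Λ ^ 2), by finiteness, fun F hF => ?_⟩
  rw [setLIntegral_congr_fun measurableSet_Ioi fun s (hs : 0 < s) => by
    rw [density_eq_ofReal_rpow_mul hq.le (hw.pos s hs).le]]
  refine hP.setLIntegral_rpow_mul_le_tsum hq hc hw.pos hac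
    (ENNReal.ofReal_pos.2 (pow_pos hΛ 2)).ne' (fun k => ?_) hF
  have hle : t k ≤ t (k + 1) := ht.monotone (lt_add_one k).le
  refine (lintegral_density_one_le (hP.pos k)).trans (ENNReal.ofReal_le_ofReal ?_)
  rw [div_le_iff₀ (hP.pos k)]
  exact ht.rho_le hq₀ hq₁ hb₀ hb₁ (right_mem_Icc.2 hle) (left_mem_Icc.2 hle)

theorem exists_tsum_le_setLIntegral_density (hq₀ : 0 < q₀) (hq₁ : 0 < q₁) (hb₀ : IsSV0 q₀ b₀)
    (hb₁ : IsSV0 q₁ b₁) (hq : 0 < q) (hw : IsIntermediateWeight w) :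
    ∃ C : ℝ≥0∞, C ≠ ∞ ∧ ∀ F : ℝ → ℝ≥0∞, Monotone F →
      ∑' k, (ENNReal.ofReal (w (rho q₀ q₁ b₀ b₁ (t k))) * F (rho q₀ q₁ b₀ b₁ (t k))) ^ q ≤
        C * ∫⁻ s in Ioi 0, density q w s * F s ^ q := by
  obtain ⟨c, hc, hac⟩ := ht.exists_weight_rho_le hq₀ hq₁ hb₀ hb₁ hw
  have hP := ht.isPartition_rho hq₀ hq₁ hb₀ hb₁
  refine ⟨ENNReal.ofReal c ^ q * 2, by finiteness, fun F hF => ?_⟩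
  rw [setLIntegral_congr_fun measurableSet_Ioi fun s (hs : 0 < s) => by
    rw [density_eq_ofReal_rpow_mul hq.le (hw.pos s hs).le]]
  exact hP.tsum_le_setLIntegral_rpow_mul hq hc.le hac
    (fun k => one_le_two_mul_lintegral_density_one (hP.pos k) (ht.two_mul_rho_le k)) hF

end IsGeometricPartition

end Sampling

section WeightedHardy

variable {p q : ℝ} {b : ℝ → ℝ} {Λ : ℝ} {t : ℤ → ℝ} {D r : ℝ≥0∞} {ω : ℤ → ℝ≥0∞}

theorem lintegral_density_le_mul_tailNorm_rpow (hp : 0 < p) (hb : IsSV0 p b) (ht : IsPartition t)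
    (hΛ : 0 ≤ Λ) (hn : ∀ k, tailNorm p b (t k) ≤ Λ * tailNorm p b (t (k + 1))) (k : ℤ) :
    ∫⁻ s in Ioc (t k) (t (k + 1)), density p b s ≤
      ENNReal.ofReal Λ ^ p * ENNReal.ofReal (tailNorm p b (t (k + 1))) ^ p := by
  rw [← ENNReal.mul_rpow_of_nonneg _ _ hp.le, ← ENNReal.ofReal_mul hΛ]
  calc ∫⁻ s in Ioc (t k) (t (k + 1)), density p b s ≤ ∫⁻ s in Ioi (t k), density p b s :=
        lintegral_mono_set Ioc_subset_Ioi_self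
    _ = ENNReal.ofReal (tailNorm p b (t k)) ^ p := by
        rw [lintegral_density_Ioi hp hb (ht.pos k), ofReal_tailNorm_rpow hp hb (ht.pos k)]
    _ ≤ _ := by gcongr; exact hn k

theorem exists_tsum_mul_weightedNorm_le (σ : ℕ → Equiv.Perm ℤ) (hp : 0 < p) (hq : 0 < q)
    {M : ℝ≥0∞} (hM : M ≠ ∞) (hr : r < 1) (hD : D ≠ ∞) (hω : ∀ i k, ω k ≤ D * r ^ i * ω (σ i k)) :
    ∃ C : ℝ≥0∞, C ≠ ∞ ∧ ∀ (F : ℝ → ℝ≥0∞) (S : ℤ → Set ℝ) (a : ℤ → ℝ≥0∞),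
      (∀ k, ∫⁻ s in S k, density p b s * F s ^ p ≤ M ^ p * ∑' i, a (σ i k) ^ p) →
        ∑' k, (ω k * weightedNorm p b (S k) F) ^ q ≤ C * ∑' k, (ω k * a k) ^ q := by
  obtain ⟨K, hK, hHardy⟩ := exists_tsum_mul_tsum_rpow_le σ hp hq hr hD hω
  refine ⟨M ^ q * K, by finiteness, fun F S a h => ?_⟩
  have hnorm (k : ℤ) : weightedNorm p b (S k) F ≤ M * (∑' i, a (σ i k) ^ p) ^ (1 / p) := by
    rw [weightedNorm, one_div, ENNReal.rpow_inv_le_iff hp, ENNReal.mul_rpow_of_nonneg _ _ hp.le,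
      ENNReal.rpow_inv_rpow hp.ne']
    exact h k
  calc ∑' k, (ω k * weightedNorm p b (S k) F) ^ q
      ≤ ∑' k, M ^ q * (ω k * (∑' i, a (σ i k) ^ p) ^ (1 / p)) ^ q :=
        ENNReal.tsum_le_tsum fun k => by
          rw [← ENNReal.mul_rpow_of_nonneg _ _ hq.le, mul_left_comm]
          gcongr
          exact hnorm k
    _ = M ^ q * ∑' k, (ω k * (∑' i, a (σ i k) ^ p) ^ (1 / p)) ^ q := ENNReal.tsum_mul_left
    _ ≤ M ^ q * (K * ∑' k, (ω k * a k) ^ q) := by gcongr; exact hHardy _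
    _ = _ := (mul_assoc _ _ _).symm

variable (hp : 0 < p) (hq : 0 < q) (hb : IsSV0 p b) (ht : IsPartition t) (hΛ : 0 < Λ)
  (hn : ∀ k, tailNorm p b (t k) ≤ Λ * tailNorm p b (t (k + 1))) (hr : r < 1) (hD : D ≠ ∞)
include hp hq hb ht hΛ hn hr hD

theorem IsPartition.exists_tsum_mul_weightedNorm_Ioc_le
    (hω : ∀ k (i : ℕ), ω k ≤ D * r ^ i * ω (k - i)) :
    ∃ C : ℝ≥0∞, C ≠ ∞ ∧ ∀ F, Monotone F →
      ∑' k, (ω k * weightedNorm p b (Ioc 0 (t k)) F) ^ q ≤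
        C * ∑' k, (ω k * (ENNReal.ofReal (tailNorm p b (t k)) * F (t k))) ^ q := by
  obtain ⟨C, hC, h⟩ := exists_tsum_mul_weightedNorm_le (fun i => Equiv.subRight (i : ℤ)) (b := b)
    (M := ENNReal.ofReal Λ) hp hq ENNReal.ofReal_ne_top hr hD fun i k => hω k i
  exact ⟨C, hC, fun F hF => h F _ _ <| ht.setLIntegral_Ioc_zero_le hp hF (by positivity)
    (fun k => (ENNReal.ofReal_pos.2 (tailNorm_pos hp hb (ht.pos k))).ne')
    (lintegral_density_le_mul_tailNorm_rpow hp hb ht hΛ.le hn)⟩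

theorem IsPartition.exists_tsum_mul_weightedNorm_Ioi_le
    (hω : ∀ k (i : ℕ), ω k ≤ D * r ^ i * ω (k + i + 1)) :
    ∃ C : ℝ≥0∞, C ≠ ∞ ∧ ∀ F, Monotone F →
      ∑' k, (ω k * weightedNorm p b (Ioi (t k)) F) ^ q ≤
        C * ∑' k, (ω k * (ENNReal.ofReal (tailNorm p b (t k)) * F (t k))) ^ q := by
  obtain ⟨C, hC, h⟩ := exists_tsum_mul_weightedNorm_le
    (fun i => (Equiv.addRight (i : ℤ)).trans (Equiv.addRight 1)) (b := b)
    (M := ENNReal.ofReal Λ) hp hq ENNReal.ofReal_ne_top hr hD fun i k => hω k i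
  exact ⟨C, hC, fun F hF => h F _ _ <| ht.setLIntegral_Ioi_le hp hF (by positivity)
    (fun k => (ENNReal.ofReal_pos.2 (tailNorm_pos hp hb (ht.pos k))).ne')
    (lintegral_density_le_mul_tailNorm_rpow hp hb ht hΛ.le hn)⟩

end WeightedHardy

section DiscreteEquivalence

variable {V : Type*} [AddCommGroup V] {N₀ N₁ : V → ℝ≥0∞}
  {w : ℝ → ℝ} {q q₀ q₁ : ℝ} {b₀ b₁ : ℝ → ℝ} {Λ : ℝ} {t : ℤ → ℝ}

namespace IsGeometricPartition

variable (ht : IsGeometricPartition q₀ q₁ b₀ b₁ Λ t) (hq₀ : 0 < q₀) (hq₁ : 0 < q₁)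
  (hb₀ : IsSV0 q₀ b₀) (hb₁ : IsSV0 q₁ b₁) (hq : 0 < q)
include ht hq₀ hq₁ hb₀ hb₁ hq

theorem exists_tsum_mul_weightedNorm_Ioc_le (hw : IsIntermediateWeight w) :
    ∃ C : ℝ≥0∞, C ≠ ∞ ∧ ∀ F : ℝ → ℝ≥0∞, Monotone F →
      ∑' k, (ENNReal.ofReal (w (rho q₀ q₁ b₀ b₁ (t k))) *
          weightedNorm q₀ b₀ (Ioc 0 (t k)) F) ^ q ≤
        C * ∑' k, (ENNReal.ofReal (w (rho q₀ q₁ b₀ b₁ (t k)) * tailNorm q₀ b₀ (t k)) *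
          F (t k)) ^ q := by
  obtain ⟨D, r, hD, hr, hdecay⟩ := hw.exists_le_pow_mul_left
  have hle (k : ℤ) : t k ≤ t (k + 1) := ht.monotone (lt_add_one k).le
  obtain ⟨C, hC, h⟩ := ht.toIsPartition.exists_tsum_mul_weightedNorm_Ioc_le hq₀ hq hb₀
    (one_pos.trans ht.one_lt)
    (fun k => ht.tailNorm_left_le hq₀ hq₁ hb₀ hb₁ (left_mem_Icc.2 (hle k))
      (right_mem_Icc.2 (hle k))) hr hD
    (ω := fun k => ENNReal.ofReal (w (rho q₀ q₁ b₀ b₁ (t k)))) fun k i =>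
      hdecay _ _ i (rho_pos hq₀ hq₁ hb₀ hb₁ (ht.pos _)) <| by
        simpa only [sub_add_cancel] using pow_mul_le_of_two_mul_le ht.two_mul_rho_le (k - i) i
  refine ⟨C, hC, fun F hF => (h F hF).trans_eq ?_⟩
  simp only [ENNReal.ofReal_mul (hw.pos _ (rho_pos hq₀ hq₁ hb₀ hb₁ (ht.pos _))).le, mul_assoc]

theorem exists_tsum_mul_weightedNorm_Ioi_le (hw : IsIntermediateWeight w) :
    ∃ C : ℝ≥0∞, C ≠ ∞ ∧ ∀ F : ℝ → ℝ≥0∞, Monotone F →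
      ∑' k, (ENNReal.ofReal (w (rho q₀ q₁ b₀ b₁ (t k))) *
          (ENNReal.ofReal (rho q₀ q₁ b₀ b₁ (t k)) * weightedNorm q₁ b₁ (Ioi (t k)) F)) ^ q ≤
        C * ∑' k, (ENNReal.ofReal (w (rho q₀ q₁ b₀ b₁ (t k)) * tailNorm q₀ b₀ (t k)) *
          F (t k)) ^ q := by
  obtain ⟨D, r, hD, hr, hgrowth⟩ := hw.exists_le_pow_mul_right
  have hP := ht.isPartition_rho hq₀ hq₁ hb₀ hb₁
  have hω (k : ℤ) : ENNReal.ofReal (rho q₀ q₁ b₀ b₁ (t k) * w (rho q₀ q₁ b₀ b₁ (t k))) =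
      ENNReal.ofReal (w (rho q₀ q₁ b₀ b₁ (t k))) * ENNReal.ofReal (rho q₀ q₁ b₀ b₁ (t k)) := by
    rw [mul_comm, ENNReal.ofReal_mul' (hP.pos k).le]
  have hn (k : ℤ) : ENNReal.ofReal (w (rho q₀ q₁ b₀ b₁ (t k)) * tailNorm q₀ b₀ (t k)) =
      ENNReal.ofReal (w (rho q₀ q₁ b₀ b₁ (t k))) * ENNReal.ofReal (rho q₀ q₁ b₀ b₁ (t k)) *
        ENNReal.ofReal (tailNorm q₁ b₁ (t k)) := by
    rw [mul_assoc, ofReal_rho_mul_tailNorm hq₁ hb₁ (ht.pos k),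
      ENNReal.ofReal_mul (hw.pos _ (hP.pos k)).le]
  obtain ⟨C, hC, h⟩ := ht.toIsPartition.exists_tsum_mul_weightedNorm_Ioi_le hq₁ hq hb₁
    (one_pos.trans ht.one_lt) (fun k => (ht.tailNorm_eq k).le) hr hD
    (ω := fun k => ENNReal.ofReal (rho q₀ q₁ b₀ b₁ (t k) * w (rho q₀ q₁ b₀ b₁ (t k)))) fun k i =>
      hgrowth _ _ i (hP.pos k) <|
        (pow_mul_le_of_two_mul_le ht.two_mul_rho_le k i).trans (hP.monotone (lt_add_one _).le)
  refine ⟨C, hC, fun F hF => ?_⟩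
  simpa only [hω, hn, mul_assoc] using h F hF

theorem exists_tsum_le_tsum_KFun_interpNorm (h₀ : IsQuasiSeminorm N₀) (h₁ : IsQuasiSeminorm N₁)
    (hw : ∀ s, 0 < s → 0 < w s) :
    ∃ C : ℝ≥0∞, C ≠ ∞ ∧ ∀ f : V,
      ∑' k, (ENNReal.ofReal (w (rho q₀ q₁ b₀ b₁ (t k)) * tailNorm q₀ b₀ (t k)) *
          KFun N₀ N₁ (t k) f) ^ q ≤
        C * ∑' k, (ENNReal.ofReal (w (rho q₀ q₁ b₀ b₁ (t k))) *
          KFun (interpNorm N₀ N₁ 0 q₀ b₀) (interpNorm N₀ N₁ 0 q₁ b₁)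
            (rho q₀ q₁ b₀ b₁ (t k)) f) ^ q := by
  obtain ⟨C, hC, h⟩ := exists_tailNorm_mul_KFun_le h₀ h₁ hq₀ hq₁ hb₀ hb₁
  refine ⟨C ^ q, by finiteness, fun f => ?_⟩
  rw [← ENNReal.tsum_mul_left]
  refine ENNReal.tsum_le_tsum fun k => ?_
  rw [← ENNReal.mul_rpow_of_nonneg _ _ hq.le,
    ENNReal.ofReal_mul (hw _ (rho_pos hq₀ hq₁ hb₀ hb₁ (ht.pos k))).le, mul_assoc, mul_left_comm C]
  gcongr ?_ ^ q
  gcongr _ * ?_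
  exact h _ (ht.pos k) f

theorem exists_tsum_KFun_interpNorm_le_tsum (h₀ : IsQuasiSeminorm N₀) (h₁ : IsQuasiSeminorm N₁)
    (hw : IsIntermediateWeight w) :
    ∃ C : ℝ≥0∞, C ≠ ∞ ∧ ∀ f : V,
      ∑' k, (ENNReal.ofReal (w (rho q₀ q₁ b₀ b₁ (t k))) *
          KFun (interpNorm N₀ N₁ 0 q₀ b₀) (interpNorm N₀ N₁ 0 q₁ b₁)
            (rho q₀ q₁ b₀ b₁ (t k)) f) ^ q ≤
        C * ∑' k, (ENNReal.ofReal (w (rho q₀ q₁ b₀ b₁ (t k)) * tailNorm q₀ b₀ (t k)) *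
          KFun N₀ N₁ (t k) f) ^ q := by
  obtain ⟨C, hC, hK⟩ := exists_KFun_interpNorm_le h₀ h₁ hq₀ hq₁ hb₀ hb₁
  obtain ⟨C₀, hC₀, hl⟩ := ht.exists_tsum_mul_weightedNorm_Ioc_le hq₀ hq₁ hb₀ hb₁ hq hw
  obtain ⟨C₁, hC₁, hr⟩ := ht.exists_tsum_mul_weightedNorm_Ioi_le hq₀ hq₁ hb₀ hb₁ hq hw
  refine ⟨C ^ q * 2 ^ q * (C₀ + C₁), by finiteness, fun f => ?_⟩
  set K := fun s => KFun N₀ N₁ s f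
  set ω := fun k => ENNReal.ofReal (w (rho q₀ q₁ b₀ b₁ (t k)))
  set x := fun k => ω k * weightedNorm q₀ b₀ (Ioc 0 (t k)) K
  set y := fun k =>
    ω k * (ENNReal.ofReal (rho q₀ q₁ b₀ b₁ (t k)) * weightedNorm q₁ b₁ (Ioi (t k)) K)
  set S := ∑' k, (ENNReal.ofReal (w (rho q₀ q₁ b₀ b₁ (t k)) * tailNorm q₀ b₀ (t k)) *
    KFun N₀ N₁ (t k) f) ^ q
  have hk (k : ℤ) : (ω k * KFun (interpNorm N₀ N₁ 0 q₀ b₀) (interpNorm N₀ N₁ 0 q₁ b₁)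
      (rho q₀ q₁ b₀ b₁ (t k)) f) ^ q ≤ C ^ q * 2 ^ q * (x k ^ q + y k ^ q) :=
    calc _ ≤ (C * (x k + y k)) ^ q := by
          rw [← mul_add, mul_left_comm]
          gcongr ?_ ^ q
          gcongr _ * ?_
          exact hK _ (ht.pos k) f
      _ ≤ C ^ q * (2 ^ q * (x k ^ q + y k ^ q)) := by
          rw [ENNReal.mul_rpow_of_nonneg _ _ hq.le]
          gcongr
          exact ENNReal.add_rpow_le_two_rpow_mul_rpow_add_rpow _ _ hq.le
      _ = _ := (mul_assoc _ _ _).symm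
  calc _ ≤ C ^ q * 2 ^ q * (∑' k, x k ^ q + ∑' k, y k ^ q) := by
        rw [← ENNReal.tsum_add, ← ENNReal.tsum_mul_left]
        exact ENNReal.tsum_le_tsum hk
    _ ≤ C ^ q * 2 ^ q * (C₀ * S + C₁ * S) := by
        gcongr
        exacts [hl K (KFun_mono f), hr K (KFun_mono f)]
    _ = _ := by ring

end IsGeometricPartition

end DiscreteEquivalence

section Reiteration

variable {V : Type*} [AddCommGroup V] {N₀ N₁ : V → ℝ≥0∞} {q q₀ q₁ θ : ℝ} {b b₀ b₁ : ℝ → ℝ}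
  {Λ : ℝ} {t : ℤ → ℝ}

theorem interpNorm_btilde_rpow (hq₀ : 0 < q₀) (hq₁ : 0 < q₁) (hb₀ : IsSV0 q₀ b₀)
    (hb₁ : IsSV0 q₁ b₁) (hq : 0 < q) (hb : ∀ s, 0 < s → 0 < b s) (f : V) :
    interpNorm N₀ N₁ 0 q (btilde θ q q₀ q₁ b b₀ b₁) f ^ q =
      ∫⁻ s in Ioi 0, ENNReal.ofReal
          (rho q₀ q₁ b₀ b₁ s ^ (-θ) * b (rho q₀ q₁ b₀ b₁ s) * tailNorm q₀ b₀ s) ^ q *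
        density q₁ (fun s => (tailNorm q₁ b₁ s)⁻¹ * b₁ s) s * KFun N₀ N₁ s f ^ q := by
  rw [interpNorm_zero_eq_weightedNorm hq (fun s => btilde_pos hq₀ hq₁ hb₀ hb₁ hb),
    weightedNorm_rpow hq]
  exact setLIntegral_congr_fun measurableSet_Ioi fun s (hs : 0 < s) => by
    rw [density_btilde hq hq₀ hq₁ hb₀ hb₁ hb hs]

theorem le_rpow_one_div_mul_of_rpow_le {x y C : ℝ≥0∞} (hq : 0 < q) (h : x ^ q ≤ C * y ^ q) :
    x ≤ C ^ (1 / q) * y := by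
  rwa [← ENNReal.rpow_le_rpow_iff hq, ENNReal.mul_rpow_of_nonneg _ _ hq.le, one_div,
    ENNReal.rpow_inv_rpow hq.ne']

namespace IsGeometricPartition

variable (ht : IsGeometricPartition q₀ q₁ b₀ b₁ Λ t) (h₀ : IsQuasiSeminorm N₀)
  (h₁ : IsQuasiSeminorm N₁) (hq₀ : 0 < q₀) (hq₁ : 0 < q₁) (hb₀ : IsSV0 q₀ b₀) (hb₁ : IsSV0 q₁ b₁)
  (hq : 0 < q) (hθ₀ : 0 < θ) (hθ₁ : θ < 1) (hb : IsSlowlyVarying b)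
include ht h₀ h₁ hq₀ hq₁ hb₀ hb₁ hq hθ₀ hθ₁ hb

theorem exists_interpNorm_interpNorm_le_interpNorm_btilde :
    ∃ C : ℝ≥0∞, C ≠ ∞ ∧ ∀ f : V,
      interpNorm (interpNorm N₀ N₁ 0 q₀ b₀) (interpNorm N₀ N₁ 0 q₁ b₁) θ q b f ≤
        C * interpNorm N₀ N₁ 0 q (btilde θ q q₀ q₁ b b₀ b₁) f := by
  have hw := hb.isIntermediateWeight hθ₀ hθ₁
  obtain ⟨C, hC, hX⟩ := ht.exists_setLIntegral_density_le_tsum hq₀ hq₁ hb₀ hb₁ hq hw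
  obtain ⟨D, hD, hXN⟩ := ht.exists_tsum_KFun_interpNorm_le_tsum hq₀ hq₁ hb₀ hb₁ hq h₀ h₁ hw
  obtain ⟨E, hE, hN⟩ := ht.exists_tsum_le_setLIntegral_tailNorm hq₀ hq₁ hb₀ hb₁ hq hw
  refine ⟨(C * (D * E)) ^ (1 / q), by finiteness, fun f => le_rpow_one_div_mul_of_rpow_le hq ?_⟩
  rw [interpNorm_rpow hq hb.pos, interpNorm_btilde_rpow hq₀ hq₁ hb₀ hb₁ hq hb.pos, mul_assoc,
    mul_assoc]
  exact (hX _ (KFun_mono f)).trans <| mul_le_mul_right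
    ((hXN f).trans (mul_le_mul_right (hN _ (KFun_mono f)) D)) C

theorem exists_interpNorm_btilde_le_interpNorm_interpNorm :
    ∃ C : ℝ≥0∞, C ≠ ∞ ∧ ∀ f : V,
      interpNorm N₀ N₁ 0 q (btilde θ q q₀ q₁ b b₀ b₁) f ≤
        C * interpNorm (interpNorm N₀ N₁ 0 q₀ b₀) (interpNorm N₀ N₁ 0 q₁ b₁) θ q b f := by
  have hw := hb.isIntermediateWeight hθ₀ hθ₁
  obtain ⟨C, hC, hN⟩ := ht.exists_setLIntegral_tailNorm_le_tsum hq₀ hq₁ hb₀ hb₁ hq hw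
  obtain ⟨D, hD, hNX⟩ := ht.exists_tsum_le_tsum_KFun_interpNorm hq₀ hq₁ hb₀ hb₁ hq h₀ h₁ hw.pos
  obtain ⟨E, hE, hX⟩ := ht.exists_tsum_le_setLIntegral_density hq₀ hq₁ hb₀ hb₁ hq hw
  refine ⟨(C * (D * E)) ^ (1 / q), by finiteness, fun f => le_rpow_one_div_mul_of_rpow_le hq ?_⟩
  rw [interpNorm_rpow hq hb.pos, interpNorm_btilde_rpow hq₀ hq₁ hb₀ hb₁ hq hb.pos, mul_assoc,
    mul_assoc]
  exact (hN _ (KFun_mono f)).trans <| mul_le_mul_right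
    ((hNX f).trans (mul_le_mul_right (hX _ (KFun_mono f)) D)) C

end IsGeometricPartition

theorem exists_ofReal_mul_le_and_le {α : Type*} {X Y : α → ℝ≥0∞} {C D : ℝ≥0∞} (hC : C ≠ ∞)
    (hD : D ≠ ∞) (hXY : ∀ f, X f ≤ C * Y f) (hYX : ∀ f, Y f ≤ D * X f) :
    ∃ c C : ℝ, 0 < c ∧ 0 < C ∧
      ∀ f, ENNReal.ofReal c * Y f ≤ X f ∧ X f ≤ ENNReal.ofReal C * Y f := by
  have hle {A : ℝ≥0∞} (hA : A ≠ ∞) : A ≤ ENNReal.ofReal (A.toReal + 1) :=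
    (ENNReal.le_ofReal_iff_toReal_le hA (by positivity)).2 (le_add_of_nonneg_right zero_le_one)
  refine ⟨(D.toReal + 1)⁻¹, C.toReal + 1, by positivity, by positivity, fun f => ⟨?_, ?_⟩⟩
  · rw [ENNReal.ofReal_inv_of_pos (by positivity), mul_comm, ← div_eq_mul_inv]
    exact ENNReal.div_le_of_le_mul' ((hYX f).trans (by gcongr; exact hle hD))
  · exact (hXY f).trans (by gcongr; exact hle hC)

end Reiteration

end LimitingReiteration

open LimitingReiteration in
theorem mainTheorem7_general {V : Type*} [AddCommGroup V] (A₀ A₁ : V → ℝ≥0∞)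
    (hA₀ : IsQuasiSeminorm A₀) (hA₁ : IsQuasiSeminorm A₁)
    (q₀ q₁ q θ : ℝ) (hq₀ : 0 < q₀) (hq₁ : 0 < q₁) (hq : 0 < q) (hθ₀ : 0 < θ) (hθ₁ : θ < 1)
    (b₀ b₁ b : ℝ → ℝ) (hb₀ : IsSV0 q₀ b₀) (hb₁ : IsSV0 q₁ b₁) (hb : IsSlowlyVarying b)
    (hρ_zero : Tendsto (rho q₀ q₁ b₀ b₁) (𝓝[>] 0) (𝓝 0))
    (hρ_growth : ∃ α : ℝ, 0 < α ∧
      EquivNondecreasing fun t => rho q₀ q₁ b₀ b₁ t * tailNorm q₁ b₁ t ^ α) :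
    interpSpace (interpNorm A₀ A₁ 0 q₀ b₀) (interpNorm A₀ A₁ 0 q₁ b₁) θ q b =
      interpSpace A₀ A₁ 0 q (btilde θ q q₀ q₁ b b₀ b₁) ∧
    ∃ c C : ℝ, 0 < c ∧ 0 < C ∧ ∀ f ∈ interpSpace A₀ A₁ 0 q (btilde θ q q₀ q₁ b b₀ b₁),
      ENNReal.ofReal c * interpNorm A₀ A₁ 0 q (btilde θ q q₀ q₁ b b₀ b₁) f ≤
        interpNorm (interpNorm A₀ A₁ 0 q₀ b₀) (interpNorm A₀ A₁ 0 q₁ b₁) θ q b f ∧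
      interpNorm (interpNorm A₀ A₁ 0 q₀ b₀) (interpNorm A₀ A₁ 0 q₁ b₁) θ q b f ≤
        ENNReal.ofReal C * interpNorm A₀ A₁ 0 q (btilde θ q q₀ q₁ b b₀ b₁) f := by
  obtain ⟨α, hα, hρα⟩ := hρ_growth
  obtain ⟨Λ, t, ht⟩ := exists_isGeometricPartition hq₀ hq₁ hb₀ hb₁ hρ_zero hα hρα
  obtain ⟨C, hC, hXA⟩ := ht.exists_interpNorm_interpNorm_le_interpNorm_btilde hA₀ hA₁ hq₀ hq₁
    hb₀ hb₁ hq hθ₀ hθ₁ hb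
  obtain ⟨D, hD, hAX⟩ := ht.exists_interpNorm_btilde_le_interpNorm_interpNorm hA₀ hA₁ hq₀ hq₁
    hb₀ hb₁ hq hθ₀ hθ₁ hb
  obtain ⟨c, C', hc, hC', h⟩ := exists_ofReal_mul_le_and_le hC hD hXA hAX
  refine ⟨Set.ext fun f => ?_, c, C', hc, hC', fun f _ => h f⟩
  rw [mem_interpSpace_iff hq hb.pos,
    mem_interpSpace_iff hq fun s => btilde_pos hq₀ hq₁ hb₀ hb₁ hb.pos]
  exact ⟨fun hf => (hAX f).trans_lt (ENNReal.mul_lt_top hD.lt_top hf),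
    fun hf => (hXA f).trans_lt (ENNReal.mul_lt_top hC.lt_top hf)⟩

theorem mainTheorem7 {𝕜 : Type*} [RCLike 𝕜] {V : Type*} [AddCommGroup V] [Module 𝕜 V]
    [TopologicalSpace V] [IsTopologicalAddGroup V] [ContinuousSMul 𝕜 V] [T2Space V]
    (A₀ A₁ : V → ℝ≥0∞)
    (hA₀ : LimitingReiteration.IsEmbeddedQuasiNorm 𝕜 A₀)
    (hA₁ : LimitingReiteration.IsEmbeddedQuasiNorm 𝕜 A₁)
    (q₀ q₁ q θ : ℝ) (hq₀ : 0 < q₀) (hq₁ : 0 < q₁) (hq : 0 < q) (hθ₀ : 0 < θ) (hθ₁ : θ < 1)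
    (b₀ b₁ b : ℝ → ℝ)
    (hb₀ : LimitingReiteration.IsSV0 q₀ b₀) (hb₁ : LimitingReiteration.IsSV0 q₁ b₁)
    (hb : LimitingReiteration.IsSlowlyVarying b)
    (hρ_mono : MonotoneOn (LimitingReiteration.rho q₀ q₁ b₀ b₁) (Ioi 0))
    (hρ_zero : Tendsto (LimitingReiteration.rho q₀ q₁ b₀ b₁) (𝓝[>] 0) (𝓝 0))
    (hρ_top : Tendsto (LimitingReiteration.rho q₀ q₁ b₀ b₁) atTop atTop)
    (h_ne : q₀ ≠ q₁ → ∃ ε : ℝ, 0 < ε ∧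
      LimitingReiteration.EquivNondecreasing (LimitingReiteration.rhoEps ε q₀ q₁ b₀ b₁))
    (h_eq : q₀ = q₁ → LimitingReiteration.KSurjective A₀ A₁ ∧
      ∃ c C : ℝ, 0 < c ∧ 0 < C ∧ ∀ᵐ t ∂(volume.restrict (Ioi (0 : ℝ))),
        c * (t⁻¹ * b₁ t ^ q₁ / LimitingReiteration.tail q₁ b₁ t) ≤
            deriv (LimitingReiteration.rho q₀ q₁ b₀ b₁) t / LimitingReiteration.rho q₀ q₁ b₀ b₁ t ∧
          deriv (LimitingReiteration.rho q₀ q₁ b₀ b₁) t / LimitingReiteration.rho q₀ q₁ b₀ b₁ t ≤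
            C * (t⁻¹ * b₁ t ^ q₁ / LimitingReiteration.tail q₁ b₁ t)) :
    LimitingReiteration.interpSpace
        (LimitingReiteration.interpNorm A₀ A₁ 0 q₀ b₀)
        (LimitingReiteration.interpNorm A₀ A₁ 0 q₁ b₁) θ q b =
      LimitingReiteration.interpSpace A₀ A₁ 0 q
        (LimitingReiteration.btilde θ q q₀ q₁ b b₀ b₁) ∧
    ∃ c C : ℝ, 0 < c ∧ 0 < C ∧
      ∀ f ∈ LimitingReiteration.interpSpace A₀ A₁ 0 q
          (LimitingReiteration.btilde θ q q₀ q₁ b b₀ b₁),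
        ENNReal.ofReal c * LimitingReiteration.interpNorm A₀ A₁ 0 q
            (LimitingReiteration.btilde θ q q₀ q₁ b b₀ b₁) f ≤
          LimitingReiteration.interpNorm
            (LimitingReiteration.interpNorm A₀ A₁ 0 q₀ b₀)
            (LimitingReiteration.interpNorm A₀ A₁ 0 q₁ b₁) θ q b f ∧
        LimitingReiteration.interpNorm
            (LimitingReiteration.interpNorm A₀ A₁ 0 q₀ b₀)
            (LimitingReiteration.interpNorm A₀ A₁ 0 q₁ b₁) θ q b f ≤
          ENNReal.ofReal C * LimitingReiteration.interpNorm A₀ A₁ 0 q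
            (LimitingReiteration.btilde θ q q₀ q₁ b b₀ b₁) f := by
  refine mainTheorem7_general A₀ A₁ hA₀.isQuasiSeminorm hA₁.isQuasiSeminorm q₀ q₁ q θ hq₀ hq₁ hq
    hθ₀ hθ₁ b₀ b₁ b hb₀ hb₁ hb hρ_zero ?_
  by_cases h : q₀ = q₁
  · obtain ⟨-, c, C, hc, -, hρ'⟩ := h_eq h
    exact LimitingReiteration.exists_equivNondecreasing_of_deriv_rho hq₀ hq₁ hb₀ hb₁ hc
      (hρ'.mono fun _ ht => ht.1)
  · obtain ⟨ε, hε, hρε⟩ := h_ne h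
    exact LimitingReiteration.exists_equivNondecreasing_of_rhoEps hq₀ hq₁ hb₀ hb₁ hε hρε
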